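/- **Setting.** A discounted two-player turn-based stochastic game $\mathcal M=(\mathcal S,\mathcal A,P,r,\gamma)$ has a finite state set $\mathcal S=\mathcal S_1\sqcup\mathcal S_2$ (player 1 moves in $\mathcal S_1$ and maximizes, player 2 moves in $\mathcal S_2$ and minimizes), a nonempty finite set $\mathcal A_s\subseteq\mathcal A$ of available actions at each $s$, transition probabilities $P(\cdot\mid s,a)$, rewards $r(s,a)\in[0,1]$ and $\gamma\in[0,1)$. A strategy $\pi=(\pi_1,\pi_2)$ chooses an available action at each state of $\mathcal S_1$, respectively $\mathcal S_2$; $V^\pi(s)=\mathbb E[\sum_{i\ge0}\gamma^i r(s_i,\pi(s_i))\mid s_0=s]$. A strategy $\pi^*$ is a Nash equilibrium if $V^{\pi_1,\pi_2^*}\le V^{\pi^*}\le V^{\pi_1^*,\pi_2}$ for all $\pi_1,\pi_2$, and $v^*=V^{\pi^*}$. A strategy $\pi$ is $\epsilon$-optimal if $V^{\bar\pi_1,\pi_2}(s)-v^*(s)\le\epsilon$ and $V^{\pi_1,\bar\pi_2}(s)-v^*(s)\ge-\epsilon$ for all $s,\bar\pi_1,\bar\pi_2$. Features are a map $\phi:\mathcal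 S\times\mathcal A\to\mathbb R^K$; a transition model $\tilde P$ embeds in $\phi$ if $\tilde P(s'\mid s,a)=\sum_k\phi_k(s,a)\psi_k(s')$ for some $\psi_1,\dots,\psi_K:\mathcal S\to\mathbb R$ and all $s,a,s'$. Let $\|p-q\|_{TV}=\sum_s|p(s)-q(s)|$. **Parametrization.** For $w\in\mathbb R^K$ let $Q_w(s,a)=r(s,a)+\gamma\phi(s,a)^Tw$; $V_w(s)$ is $\max_{a\in\mathcal A_s}Q_w(s,a)$ on $\mathcal S_1$ and $\min_{a\in\mathcal A_s}Q_w(s,a)$ on $\mathcal S_2$, and $\pi_w(s)$ is an action attaining it. For a nonempty finite set $\theta\subset\mathbb R^K$ let $V_\theta(s)=\max_{w\in\theta}V_w(s)$, and let $\pi_\theta(s)$ be an action attaining $V_w(s)$ for some $w\in\theta$ with $V_w(s)=V_\theta(s)$. Ties are broken arbitrarily. **Anchors.** $\mathcal K=\{(s_k,a_k)\}_{k\le K}$ is a set of $K$ state-action pairs, $\Phi_{\mathcal K}$ is the matrix with rows $\phi(s_k,a_k)^T$, and $\Phi_{\mathcal K}$ is invertible with $\|\Phi_{\mathcal K}^{-1}\|_\infty\le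 L$ for a given $L>0$; moreover $\|\phi(s,a)\|_1\le1$ for all $s$ and $a\in\mathcal A_s$. **Algorithm 1** (input $\mathcal M,\epsilon,\delta$). $R=\lceil c_R\frac1{1-\gamma}\log\frac1{(1-\gamma)\epsilon}\rceil$, $T=\lceil c_T L^2\log(KR/\delta)/(\epsilon^2(1-\gamma)^6)\rceil$, $w^{(0)}=0$. For $t=1,\dots,R$: for every $k$ draw $T$ fresh samples from $P(\cdot\mid s_k,a_k)$, let $M^{(t)}(k)$ be the average over them of $V_{w^{(t-1)}}$ projected to $[0,\frac1{1-\gamma}]$, and $w^{(t)}=\Phi_{\mathcal K}^{-1}M^{(t)}$. Output $w^{(R)}$. **Algorithm 2** (input $\mathcal M,\epsilon,\delta$). $R'=\lceil c_1\log\frac1{\epsilon(1-\gamma)}\rceil$, $R=\lceil c_2R'/(1-\gamma)\rceil$, $\Lambda=\log(R'RK/\delta)$, $m=\lceil c_3L^2\Lambda/(\epsilon^2(1-\gamma)^4)\rceil$, $m_1=\lceil c_4L^2\Lambda/(1-\gamma)^2\rceil$, $\epsilon_1=c_5\frac L{1-\gamma}\sqrt{\Lambda/m}$, $\epsilon^{(i)}=\epsilon_1+c_6\frac{L2^{-i}}{1-\gamma}\sqrt{\Lambda/m_1}$,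 $\theta^{(0,0)}=\{0\}$. For $i=0,\dots,R'$: let $M^{(i,0)}(k)$ be the average of $V_{\theta^{(i,0)}}$ over $m$ fresh samples from $P(\cdot\mid s_k,a_k)$; for $j=1,\dots,R$ let $M^{(i,j)}(k)$ be $M^{(i,0)}(k)$ plus the average of $V_{\theta^{(i,j-1)}}-V_{\theta^{(i,0)}}$ over $m_1$ fresh samples from $P(\cdot\mid s_k,a_k)$, $w^{(i,j)}=\Phi_{\mathcal K}^{-1}M^{(i,j)}$, and $\theta^{(i,j)}=\theta^{(i,j-1)}\cup\{w^{(i,j)}-\epsilon^{(i)}(1,\dots,1)^T\}$; let $\theta^{(i+1,0)}=\theta^{(i,R)}$. Output $\theta^{(R',R)}$. **Algorithm 3** (input $\mathcal M,\epsilon,\delta$). Let $\mathcal M'$ be $\mathcal M$ with reward $1-r$ and the objectives of the players exchanged (player 1 minimizes, player 2 maximizes). Run Algorithm 2 independently on $\mathcal M$ and on $\mathcal M'$, with outputs $\theta$ and $\eta$. Output the strategy that plays $\pi_\theta(s)$ at $s\in\mathcal S_1$ and $\pi'_\eta(s)$ at $s\in\mathcal S_2$, where $\pi'_\eta$ is the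 strategy $\pi_\eta$ of the game $\mathcal M'$. **Theorem.** There are positive absolute constants $c_R,c_T,c_1,\dots,c_6$ such that the following holds for all $\mathcal M,\phi,\mathcal K,L$ as above and all $\epsilon,\delta\in(0,1)$. Suppose that the features are nonnegative, and that there are a transition model $\tilde P$ that embeds in $\phi$ and $\xi\in[0,1]$ such that $\|P(\cdot\mid s,a)-\tilde P(\cdot\mid s,a)\|_{TV}\le\xi$ for all $(s,a)\in\mathcal S\times\mathcal A$ and $P(\cdot\mid s,a)=\tilde P(\cdot\mid s,a)$ for $(s,a)\in\mathcal K$. Then, for the game $\mathcal M$ (with the true model $P$), with probability at least $1-2\delta$ the output of Algorithm 3 is a $\left(\frac{2\xi}{(1-\gamma)^2}+2\epsilon\right)$-optimal strategy, and with probability at least $1-\delta$ the strategy $\pi_{w^{(R)}}$ given by the output of Algorithm 1 is $\left(\frac{2\xi}{(1-\gamma)^2}+2\epsilon\right)$-optimal. -/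

import Mathlib

open MeasureTheory ProbabilityTheory
open scoped Matrix

noncomputable section

namespace TwoPlayerGame

/-- A discounted two-player turn-based stochastic game. The maximizing player moves at the
states in `maxStates`, the minimizing player moves at all other states; `act s` is the set of the
finitely many actions available at `s`. The reward has values in `[0, 1]`. -/
structure Game (S A : Type*) where
  maxStates : Set S
  act : S → Finset A
  act_nonempty : ∀ s, (act s).Nonempty
  P : S → A → PMF S
  r : S → A → ℝ
  r_nonneg : ∀ s a, 0 ≤ r s a
  r_le_one : ∀ s a, r s a ≤ 1
  γ : ℝ
  γ_nonneg : 0 ≤ γ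
  γ_lt_one : γ < 1

variable {S A : Type*} {K : ℕ}

namespace Game

/-- The flipped game: rewards `1 - r`, and the objectives of the two players are exchanged, so that
the maximizing player now moves at the states where the minimizing player used to move. -/
def flip (G : Game S A) : Game S A where
  maxStates := G.maxStatesᶜ
  act := G.act
  act_nonempty := G.act_nonempty
  P := G.P
  r := fun s a => 1 - G.r s a
  r_nonneg := fun s a => sub_nonneg.2 (G.r_le_one s a)
  r_le_one := fun s a => sub_le_self 1 (G.r_nonneg s a)
  γ := G.γ
  γ_nonneg := G.γ_nonneg
  γ_lt_one := G.γ_lt_one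

/-! ### Strategies, values, equilibria -/

/-- Deterministic stationary strategies of player 1 (the maximizer). -/
abbrev Strategy₁ (G : Game S A) : Type _ := (s : {s : S // s ∈ G.maxStates}) → {a : A // a ∈ G.act s}

/-- Deterministic stationary strategies of player 2 (the minimizer). -/
abbrev Strategy₂ (G : Game S A) : Type _ := (s : {s : S // s ∉ G.maxStates}) → {a : A // a ∈ G.act s}

/-- A strategy is a pair of strategies of the two players. -/
abbrev Strategy (G : Game S A) : Type _ := G.Strategy₁ × G.Strategy₂

open Classical in
/-- The action that a strategy plays at the state `s`. -/
def play (G : Game S A) (π : G.Strategy) (s : S) : A :=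
  if h : s ∈ G.maxStates then (π.1 ⟨s, h⟩ : A) else (π.2 ⟨s, h⟩ : A)

theorem play_mem (G : Game S A) (π : G.Strategy) (s : S) : G.play π s ∈ G.act s := by
  unfold play
  split_ifs with h
  · exact (π.1 ⟨s, h⟩).2
  · exact (π.2 ⟨s, h⟩).2

/-- Every choice of available actions is played by a strategy. -/
theorem exists_play (G : Game S A) (f : S → A) (hf : ∀ s, f s ∈ G.act s) :
    ∃ π : G.Strategy, ∀ s, G.play π s = f s := by
  refine ⟨(fun s => ⟨f s, hf s⟩, fun s => ⟨f s, hf s⟩), fun s => ?_⟩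
  unfold play
  split_ifs <;> rfl

section Values

variable [Fintype S] [MeasurableSpace S] [MeasurableSingletonClass S]

/-- The transition kernel from the trajectory up to time `n` to the state at time `n + 1`, when the
strategy `π` is used. -/
def stepKernel (G : Game S A) (π : G.Strategy) (n : ℕ) :
    Kernel (Finset.Iic n → S) S :=
  Kernel.ofFunOfCountable fun h =>
    (G.P (h ⟨n, Finset.mem_Iic.2 le_rfl⟩) (G.play π (h ⟨n, Finset.mem_Iic.2 le_rfl⟩))).toMeasure

instance (G : Game S A) (π : G.Strategy) (n : ℕ) : IsMarkovKernel (G.stepKernel π n) :=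
  ⟨fun h => inferInstanceAs (IsProbabilityMeasure
    (G.P (h ⟨n, Finset.mem_Iic.2 le_rfl⟩)
      (G.play π (h ⟨n, Finset.mem_Iic.2 le_rfl⟩))).toMeasure)⟩

/-- The law of the infinite trajectory that starts at `s` and follows the strategy `π`. -/
def trajLaw (G : Game S A) (π : G.Strategy) (s : S) : Measure (ℕ → S) :=
  Kernel.trajMeasure (X := fun _ => S) (Measure.dirac s) (G.stepKernel π)

/-- The value function of `π`: the expected total discounted reward. -/
def value (G : Game S A) (π : G.Strategy) (s : S) : ℝ :=
  ∫ ω, ∑' i : ℕ, G.γ ^ i * G.r (ω i) (G.play π (ω i)) ∂(G.trajLaw π s)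

/-- Nash equilibrium strategies. -/
def IsNash (G : Game S A) (π : G.Strategy) : Prop :=
  (∀ (π₁ : G.Strategy₁) (s : S), G.value (π₁, π.2) s ≤ G.value π s) ∧
  (∀ (π₂ : G.Strategy₂) (s : S), G.value π s ≤ G.value (π.1, π₂) s)

/-- `v` is the equilibrium value function: the value function of a Nash equilibrium strategy. -/
def IsEquilibriumValue (G : Game S A) (v : S → ℝ) : Prop :=
  ∃ π : G.Strategy, G.IsNash π ∧ G.value π = v

/-- `ε`-optimal strategies: no deviation of player 1 gains more than `ε` over the equilibrium value,
no deviation of player 2 brings the value more than `ε` below it. -/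
def IsOptimalUpTo (G : Game S A) (ε : ℝ) (π : G.Strategy) : Prop :=
  ∃ v : S → ℝ, G.IsEquilibriumValue v ∧ ∀ s : S,
    (∀ π₁ : G.Strategy₁, G.value (π₁, π.2) s - v s ≤ ε) ∧
    (∀ π₂ : G.Strategy₂, -ε ≤ G.value (π.1, π₂) s - v s)

end Values

end Game

/-! ### Features -/

/-- The transition model `P` can be embedded into the feature space of `φ`. -/
def Embeds (P : S → A → PMF S) (φ : S → A → Fin K → ℝ) : Prop :=
  ∃ ψ : Fin K → S → ℝ, ∀ s a s', (P s a s').toReal = ∑ k, φ s a k * ψ k s'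

/-- The `ℓ¹` distance of two distributions on a finite set (total variation distance without the
factor `1 / 2`). -/
def tvDist [Fintype S] (p q : PMF S) : ℝ := ∑ s, |(p s).toReal - (q s).toReal|

/-- The square matrix whose rows are the feature vectors of the anchor pairs. -/
def anchorMatrix (φ : S → A → Fin K → ℝ) (anchor : Fin K → S × A) : Matrix (Fin K) (Fin K) ℝ :=
  Matrix.of fun k => φ (anchor k).1 (anchor k).2

/-- The features of available pairs have `ℓ¹` norm at most `1`, and the matrix of the anchor pairs is
invertible with an inverse of `ℓ^∞` operator norm (maximal absolute row sum) at most `L`. -/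
def AnchorCondition (G : Game S A) (φ : S → A → Fin K → ℝ) (anchor : Fin K → S × A) (L : ℝ) :
    Prop :=
  (∀ s, ∀ a ∈ G.act s, ∑ k, |φ s a k| ≤ 1) ∧
  IsUnit (anchorMatrix φ anchor).det ∧
  ∀ k, ∑ j, |(anchorMatrix φ anchor)⁻¹ k j| ≤ L

/-! ### Parametrization -/

/-- `Q_w(s, a) = r(s, a) + γ φ(s, a)ᵀ w`. -/
def Q (G : Game S A) (φ : S → A → Fin K → ℝ) (w : Fin K → ℝ) (s : S) (a : A) : ℝ :=
  G.r s a + G.γ * (φ s a ⬝ᵥ w)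

open Classical in
/-- `V_w(s)`: the maximum of `Q_w(s, ·)` over the available actions at a state of the maximizer, the
minimum at a state of the minimizer. -/
def V (G : Game S A) (φ : S → A → Fin K → ℝ) (w : Fin K → ℝ) (s : S) : ℝ :=
  if s ∈ G.maxStates then (G.act s).sup' (G.act_nonempty s) (Q G φ w s)
  else (G.act s).inf' (G.act_nonempty s) (Q G φ w s)

/-- `π` is a strategy `π_w`: it plays at every state an available action that attains the maximum
(at a state of the maximizer) or minimum (at a state of the minimizer) in `V_w`.
Ties may be broken arbitrarily. -/
def IsGreedy (G : Game S A) (φ : S → A → Fin K → ℝ) (w : Fin K → ℝ) (π : G.Strategy) : Prop :=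
  ∀ s, Q G φ w s (G.play π s) = V G φ w s

theorem exists_greedy_action (G : Game S A) (φ : S → A → Fin K → ℝ) (w : Fin K → ℝ) (s : S) :
    ∃ a ∈ G.act s, Q G φ w s a = V G φ w s := by
  unfold V
  split_ifs
  · obtain ⟨a, ha, h⟩ := Finset.exists_mem_eq_sup' (G.act_nonempty s) (Q G φ w s)
    exact ⟨a, ha, h.symm⟩
  · obtain ⟨a, ha, h⟩ := Finset.exists_mem_eq_inf' (G.act_nonempty s) (Q G φ w s)
    exact ⟨a, ha, h.symm⟩

/-- A strategy `π_w` exists. -/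
theorem exists_isGreedy (G : Game S A) (φ : S → A → Fin K → ℝ) (w : Fin K → ℝ) :
    ∃ π : G.Strategy, IsGreedy G φ w π := by
  choose f hf h using exists_greedy_action G φ w
  obtain ⟨π, hπ⟩ := G.exists_play f hf
  exact ⟨π, fun s => by rw [hπ, h]⟩

/-- Nonempty finite collections of parameter vectors. -/
abbrev Params (K : ℕ) : Type := {θ : Finset (Fin K → ℝ) // θ.Nonempty}

/-- `V_θ(s) = max_{w ∈ θ} V_w(s)`. -/
def Vmax (G : Game S A) (φ : S → A → Fin K → ℝ) (θ : Params K) (s : S) : ℝ :=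
  θ.1.sup' θ.2 fun w => V G φ w s

/-- `a` is a choice of `π_θ(s)`: an available action `a` that, for some `w ∈ θ` with maximal `V_w(s)`,
attains the optimum in `V_w(s)`. -/
def IsMaxLinearAction (G : Game S A) (φ : S → A → Fin K → ℝ) (θ : Params K) (s : S) (a : A) :
    Prop :=
  a ∈ G.act s ∧ ∃ w ∈ θ.1, V G φ w s = Vmax G φ θ s ∧ Q G φ w s a = V G φ w s

theorem exists_isMaxLinearAction (G : Game S A) (φ : S → A → Fin K → ℝ) (θ : Params K) (s : S) :
    ∃ a, IsMaxLinearAction G φ θ s a := by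
  obtain ⟨w, hw, h⟩ := Finset.exists_mem_eq_sup' θ.2 fun w => V G φ w s
  obtain ⟨a, ha, h'⟩ := exists_greedy_action G φ w s
  exact ⟨a, ha, w, hw, h.symm, h'⟩

/-! ### Sampling and the algorithms

A randomized algorithm is given by the law of its output, written in the monad of discrete
probability distributions. -/

/-- `n` independent transitions from each of the `K` anchor pairs. -/
def draws [Fintype S] [MeasurableSpace S] [MeasurableSingletonClass S]
    (P : S → A → PMF S) (anchor : Fin K → S × A) (n : ℕ) : PMF (Fin K → Fin n → S) :=
  (Measure.pi fun k : Fin K => Measure.pi fun _ : Fin n =>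
    (P (anchor k).1 (anchor k).2).toMeasure).toPMF

/-- Projection to the interval `[0, 1 / (1 - γ)]`. -/
def clip (γ x : ℝ) : ℝ := max 0 (min x (1 / (1 - γ)))

/-- The update of the basic algorithm: average the clipped values `V_w` over the samples of every
anchor pair, and apply the inverse of the anchor matrix. -/
def basicUpdate (G : Game S A) (φ : S → A → Fin K → ℝ) (anchor : Fin K → S × A) {T : ℕ}
    (w : Fin K → ℝ) (x : Fin K → Fin T → S) : Fin K → ℝ :=
  (anchorMatrix φ anchor)⁻¹ *ᵥ fun k => (1 / (T : ℝ)) * ∑ i, clip G.γ (V G φ w (x k i))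

/-- The law of the iterate `w^(t)` of the basic algorithm with `T` samples per anchor pair and
iteration. -/
def basicIterate [Fintype S] [MeasurableSpace S] [MeasurableSingletonClass S]
    (G : Game S A) (φ : S → A → Fin K → ℝ) (anchor : Fin K → S × A) (T : ℕ) :
    ℕ → PMF (Fin K → ℝ)
  | 0 => PMF.pure 0
  | t + 1 => (basicIterate G φ anchor T t).bind fun w =>
      (draws G.P anchor T).map fun x => basicUpdate G φ anchor w x

/-- Number of iterations of the basic algorithm. -/
def basicR (c γ ε : ℝ) : ℕ := ⌈c * (1 / (1 - γ) * Real.log (1 / ((1 - γ) * ε)))⌉₊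

/-- Number of samples per anchor pair and iteration of the basic algorithm. -/
def basicT (c γ ε δ L : ℝ) (K R : ℕ) : ℕ :=
  ⌈c * (L ^ 2 * Real.log (K * R / δ) / (ε ^ 2 * (1 - γ) ^ 6))⌉₊

/-- Sampled value iteration: the law of its output `w^(R)`. -/
def basicAlgorithm [Fintype S] [MeasurableSpace S] [MeasurableSingletonClass S]
    (cR cT : ℝ) (G : Game S A) (φ : S → A → Fin K → ℝ) (anchor : Fin K → S × A)
    (L ε δ : ℝ) : PMF (Fin K → ℝ) :=
  basicIterate G φ anchor (basicT cT G.γ ε δ L K (basicR cR G.γ ε)) (basicR cR G.γ ε)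

/-- The numerical constants hidden in the parameters of the variance-reduced algorithm. -/
structure VRConst where
  outer : ℝ
  inner : ℝ
  m : ℝ
  m₁ : ℝ
  shift₁ : ℝ
  shift₂ : ℝ
  outer_pos : 0 < outer
  inner_pos : 0 < inner
  m_pos : 0 < m
  m₁_pos : 0 < m₁
  shift₁_pos : 0 < shift₁
  shift₂_pos : 0 < shift₂

/-- `R'`: the outer loop runs over `i = 0, …, R'`. -/
def vrOuter (c : VRConst) (γ ε : ℝ) : ℕ := ⌈c.outer * Real.log (1 / (ε * (1 - γ)))⌉₊

/-- `R`: the inner loop runs over `j = 1, …, R`. -/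
def vrInner (c : VRConst) (γ ε : ℝ) : ℕ := ⌈c.inner * (vrOuter c γ ε / (1 - γ))⌉₊

/-- `log (R' R K / δ)`. -/
def vrLog (c : VRConst) (γ ε δ : ℝ) (K : ℕ) : ℝ :=
  Real.log ((vrOuter c γ ε : ℝ) * vrInner c γ ε * K / δ)

/-- `m`: samples per anchor pair at the beginning of an outer iteration. -/
def vrM (c : VRConst) (γ ε δ L : ℝ) (K : ℕ) : ℕ :=
  ⌈c.m * (L ^ 2 * vrLog c γ ε δ K / (ε ^ 2 * (1 - γ) ^ 4))⌉₊

/-- `m₁`: samples per anchor pair in an inner iteration. -/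
def vrM₁ (c : VRConst) (γ ε δ L : ℝ) (K : ℕ) : ℕ :=
  ⌈c.m₁ * (L ^ 2 * vrLog c γ ε δ K / (1 - γ) ^ 2)⌉₊

/-- `ε₁`. -/
def vrShift₁ (c : VRConst) (γ ε δ L : ℝ) (K : ℕ) : ℝ :=
  c.shift₁ * (L / (1 - γ) * √(vrLog c γ ε δ K / vrM c γ ε δ L K))

/-- `ε^(i)`: the confidence shift in the outer iteration `i`. -/
def vrShift (c : VRConst) (γ ε δ L : ℝ) (K i : ℕ) : ℝ :=
  vrShift₁ c γ ε δ L K +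
    c.shift₂ * (L * (2 : ℝ)⁻¹ ^ i / (1 - γ) * √(vrLog c γ ε δ K / vrM₁ c γ ε δ L K))

/-- `M^(i,0)`: the average of `V_θ` over the samples of each anchor pair. -/
def vrReference (G : Game S A) (φ : S → A → Fin K → ℝ) {m : ℕ} (θ : Params K)
    (x : Fin K → Fin m → S) (k : Fin K) : ℝ :=
  (1 / (m : ℝ)) * ∑ l, Vmax G φ θ (x k l)

open Classical in
/-- One inner iteration: from `θ = θ^(i,j-1)`, the reference `θ₀ = θ^(i,0)`, `M₀ = M^(i,0)`, the shift
`e = ε^(i)` and the samples `x`, compute `θ^(i,j)`, which adds the shifted vector `w^(i,j) - e`. -/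
def vrUpdate (G : Game S A) (φ : S → A → Fin K → ℝ) (anchor : Fin K → S × A) {m₁ : ℕ} (e : ℝ)
    (θ₀ : Params K) (M₀ : Fin K → ℝ) (θ : Params K) (x : Fin K → Fin m₁ → S) : Params K :=
  ⟨insert (fun k => ((anchorMatrix φ anchor)⁻¹ *ᵥ fun k' =>
      (1 / (m₁ : ℝ)) * ∑ l, (Vmax G φ θ (x k' l) - Vmax G φ θ₀ (x k' l)) + M₀ k') k - e) θ.1,
    Finset.insert_nonempty _ _⟩

/-- The law of `θ^(i,j)` in the inner loop, given `θ₀ = θ^(i,0)` and `M₀ = M^(i,0)`. -/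
def vrInnerLoop [Fintype S] [MeasurableSpace S] [MeasurableSingletonClass S]
    (G : Game S A) (φ : S → A → Fin K → ℝ) (anchor : Fin K → S × A) (m₁ : ℕ) (e : ℝ)
    (θ₀ : Params K) (M₀ : Fin K → ℝ) : ℕ → PMF (Params K)
  | 0 => PMF.pure θ₀
  | j + 1 => (vrInnerLoop G φ anchor m₁ e θ₀ M₀ j).bind fun θ =>
      (draws G.P anchor m₁).map fun x => vrUpdate G φ anchor e θ₀ M₀ θ x

/-- The law of `θ^(i,0)`; the collection `θ^(i+1,0)` is the result `θ^(i,R)` of the inner loop in the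
outer iteration `i`. -/
def vrOuterLoop [Fintype S] [MeasurableSpace S] [MeasurableSingletonClass S]
    (G : Game S A) (φ : S → A → Fin K → ℝ) (anchor : Fin K → S × A) (m m₁ R : ℕ)
    (e : ℕ → ℝ) : ℕ → PMF (Params K)
  | 0 => PMF.pure ⟨{0}, Finset.singleton_nonempty _⟩
  | i + 1 => (vrOuterLoop G φ anchor m m₁ R e i).bind fun θ₀ =>
      (draws G.P anchor m).bind fun x =>
        vrInnerLoop G φ anchor m₁ (e i) θ₀ (vrReference G φ θ₀ x) R

/-- One-sided Q-learning with variance reduction: the law of its output `θ^(R',R) = θ^(R'+1,0)`. -/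
def oneSidedAlgorithm [Fintype S] [MeasurableSpace S] [MeasurableSingletonClass S]
    (c : VRConst) (G : Game S A) (φ : S → A → Fin K → ℝ)
    (anchor : Fin K → S × A) (L ε δ : ℝ) : PMF (Params K) :=
  vrOuterLoop G φ anchor (vrM c G.γ ε δ L K) (vrM₁ c G.γ ε δ L K) (vrInner c G.γ ε)
    (vrShift c G.γ ε δ L K) (vrOuter c G.γ ε + 1)

/-- The two-sided algorithm: independent runs of the one-sided algorithm on the game and on the
flipped game; the law of the pair `(θ, η)` of their outputs. -/
def twoSidedAlgorithm [Fintype S] [MeasurableSpace S] [MeasurableSingletonClass S]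
    (c : VRConst) (G : Game S A) (φ : S → A → Fin K → ℝ)
    (anchor : Fin K → S × A) (L ε δ : ℝ) : PMF (Params K × Params K) :=
  (oneSidedAlgorithm c G φ anchor L ε δ).bind fun θ =>
    (oneSidedAlgorithm c G.flip φ anchor L ε δ).map fun η => (θ, η)

/-- `π` is a strategy that the two-sided algorithm builds from `(θ, η)`: player 1 plays `π_θ`, and
player 2 plays the strategy `π'_η` of the flipped game. Ties may be broken arbitrarily. -/
def IsTwoSidedStrategy (G : Game S A) (φ : S → A → Fin K → ℝ) (θη : Params K × Params K)
    (π : G.Strategy) : Prop :=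
  (∀ s ∈ G.maxStates, IsMaxLinearAction G φ θη.1 s (G.play π s)) ∧
  (∀ s ∉ G.maxStates, IsMaxLinearAction G.flip φ θη.2 s (G.play π s))

open Classical in
/-- The two-sided algorithm can always build a strategy from its data. -/
theorem exists_isTwoSidedStrategy (G : Game S A) (φ : S → A → Fin K → ℝ)
    (θη : Params K × Params K) : ∃ π : G.Strategy, IsTwoSidedStrategy G φ θη π := by
  choose f hf using exists_isMaxLinearAction G φ θη.1
  choose g hg using exists_isMaxLinearAction G.flip φ θη.2
  obtain ⟨π, hπ⟩ := G.exists_play (fun s => if s ∈ G.maxStates then f s else g s) (fun s => by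
    split_ifs
    · exact (hf s).1
    · exact (hg s).1)
  refine ⟨π, fun s hs => ?_, fun s hs => ?_⟩
  · rw [hπ, if_pos hs]
    exact hf s
  · rw [hπ, if_neg hs]
    exact hg s

end TwoPlayerGame

end

/-! The algorithms see the game only through samples at the anchor pairs, where the two models
agree, so their outputs have the same law in `G` and in `G.withTransitions P'`. It suffices to treat
the model that embeds exactly and to transfer near-optimality back
(`Game.IsOptimalUpTo.of_withTransitions`): the change of model moves the value of each strategy by
at most `ξ / (1 - γ) ^ 2`, paid once for the deviation and once for the equilibrium.

In an embedded model all expectations are linear in the features, hence determined by those at the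
anchor pairs (`expect_eq_extrapolation`); a sampling error `t` there grows to at most `L * t` at any
available pair. The benchmark is a fixed point `v` of the Bellman operator, which is an equilibrium
value. Comparisons with `v` and with values of strategies rest on the maximum principle
`le_div_of_le_discounted`.

The basic algorithm is a contraction with noise `η`: the error of the action values follows `d ↦ γ *
(d + η)`, and a greedy strategy turns a final error `d` into a loss of `2 * d / (1 - γ)`.

The variance-reduced algorithm maintains `IsLowerParams`. This invariant makes `Vmax` a subsolution
of the Bellman equation, so it lies below `v`, and it makes the actions of `π_θ` secure at least
`Vmax` for player 1 against every opponent. Nonnegative features let the downward shift absorb the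
estimation error (`vrUpdate_spec`). The sampled differences have the size of the current gap to `v`,
so a sample size free of `ε` halves the gap in each outer iteration (`vrInnerLoop_spec`,
`vrOuterLoop_spec`). The run on the flipped game gives player 2 the mirrored guarantee. -/

noncomputable section

namespace TwoPlayerGame

variable {S A : Type*} {K : ℕ}

/-! ### Expectations over finite sets -/

section Expect

variable [Fintype S]

/-- The expectation of `u` under `p`, as a finite sum. -/
def expect (p : PMF S) (u : S → ℝ) : ℝ := ∑ s, (p s).toReal * u s

theorem sum_toReal (p : PMF S) : ∑ s, (p s).toReal = 1 := by
  rw [← ENNReal.toReal_sum fun s _ => p.apply_ne_top s, ← tsum_fintype (L := .unconditional S),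
    p.tsum_coe, ENNReal.toReal_one]

theorem expect_mono (p : PMF S) {u w : S → ℝ} (h : ∀ s, u s ≤ w s) : expect p u ≤ expect p w :=
  Finset.sum_le_sum fun s _ => mul_le_mul_of_nonneg_left (h s) ENNReal.toReal_nonneg

theorem expect_const (p : PMF S) (c : ℝ) : expect p (fun _ => c) = c := by
  rw [expect, ← Finset.sum_mul, sum_toReal, one_mul]

theorem expect_add (p : PMF S) (u w : S → ℝ) :
    expect p (fun s => u s + w s) = expect p u + expect p w := by
  simp only [expect, mul_add, Finset.sum_add_distrib]

theorem expect_sub (p : PMF S) (u w : S → ℝ) :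
    expect p (fun s => u s - w s) = expect p u - expect p w := by
  simp only [expect, mul_sub, Finset.sum_sub_distrib]

theorem expect_le (p : PMF S) {u : S → ℝ} {c : ℝ} (h : ∀ s, u s ≤ c) : expect p u ≤ c :=
  (expect_mono p h).trans (expect_const p c).le

theorem le_expect (p : PMF S) {u : S → ℝ} {c : ℝ} (h : ∀ s, c ≤ u s) : c ≤ expect p u :=
  (expect_const p c).ge.trans (expect_mono p h)

theorem expect_le_expect_add (p : PMF S) {u w : S → ℝ} {d : ℝ} (h : ∀ s, u s ≤ w s + d) :
    expect p u ≤ expect p w + d := by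
  have := expect_mono p h
  rwa [expect_add, expect_const] at this

theorem abs_expect_sub_expect_le (p : PMF S) {u w : S → ℝ} {d : ℝ} (h : ∀ s, |u s - w s| ≤ d) :
    |expect p u - expect p w| ≤ d := by
  rw [abs_le, ← expect_sub]
  exact ⟨le_expect p fun s => (abs_le.1 (h s)).1, expect_le p fun s => (abs_le.1 (h s)).2⟩

theorem integral_toMeasure [MeasurableSpace S] [MeasurableSingletonClass S] (p : PMF S)
    (u : S → ℝ) : ∫ s, u s ∂p.toMeasure = expect p u := by
  rw [PMF.integral_eq_sum]
  rfl

theorem abs_expect_sub_expect_le_tvDist (p q : PMF S) {u : S → ℝ} {b : ℝ}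
    (h : ∀ s, |u s| ≤ b) : |expect p u - expect q u| ≤ tvDist p q * b := by
  rw [expect, expect, ← Finset.sum_sub_distrib, tvDist, Finset.sum_mul]
  refine (Finset.abs_sum_le_sum_abs _ _).trans (Finset.sum_le_sum fun s _ => ?_)
  rw [← sub_mul, abs_mul]
  exact mul_le_mul_of_nonneg_left (h s) (abs_nonneg _)

/-- A function that is dominated by its discounted expectations up to `e` is at most
`e / (1 - γ)`. -/
theorem le_div_of_le_discounted {γ e : ℝ} (h0 : 0 ≤ γ) (h1 : γ < 1) (p : S → PMF S) {u : S → ℝ}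
    (h : ∀ s, u s ≤ γ * expect (p s) u + e) (s : S) : u s ≤ e / (1 - γ) := by
  -- At a maximizer `m` the hypothesis reads `u m ≤ γ * u m + e`.
  obtain ⟨m, -, hm⟩ := Finset.exists_max_image Finset.univ u ⟨s, Finset.mem_univ s⟩
  have hle : expect (p m) u ≤ u m := expect_le _ fun t => hm t (Finset.mem_univ t)
  refine (hm s (Finset.mem_univ s)).trans ?_
  rw [le_div_iff₀ (by linarith)]
  nlinarith [h m, mul_le_mul_of_nonneg_left hle h0]

end Expect

namespace Game

/-! ### Optimization over the available actions -/

open Classical in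
/-- The optimum over the available actions for the player who moves at `s`. -/
def opt (G : Game S A) (s : S) (q : A → ℝ) : ℝ :=
  if s ∈ G.maxStates then (G.act s).sup' (G.act_nonempty s) q
  else (G.act s).inf' (G.act_nonempty s) q

theorem exists_eq_opt (G : Game S A) (s : S) (q : A → ℝ) : ∃ a ∈ G.act s, q a = G.opt s q := by
  unfold opt
  split_ifs
  · obtain ⟨a, ha, h⟩ := Finset.exists_mem_eq_sup' (G.act_nonempty s) q
    exact ⟨a, ha, h.symm⟩
  · obtain ⟨a, ha, h⟩ := Finset.exists_mem_eq_inf' (G.act_nonempty s) q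
    exact ⟨a, ha, h.symm⟩

theorem le_opt (G : Game S A) {s : S} (hs : s ∈ G.maxStates) (q : A → ℝ) {a : A}
    (ha : a ∈ G.act s) : q a ≤ G.opt s q := by
  rw [opt, if_pos hs]
  exact Finset.le_sup' q ha

theorem opt_le (G : Game S A) {s : S} (hs : s ∉ G.maxStates) (q : A → ℝ) {a : A}
    (ha : a ∈ G.act s) : G.opt s q ≤ q a := by
  rw [opt, if_neg hs]
  exact Finset.inf'_le q ha

theorem opt_le_opt_add (G : Game S A) (s : S) {q q' : A → ℝ} {d : ℝ}
    (h : ∀ a ∈ G.act s, q a ≤ q' a + d) : G.opt s q ≤ G.opt s q' + d := by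
  by_cases hs : s ∈ G.maxStates
  · obtain ⟨a, ha, e⟩ := G.exists_eq_opt s q
    rw [← e]
    linarith [h a ha, G.le_opt hs q' ha]
  · obtain ⟨a, ha, e⟩ := G.exists_eq_opt s q'
    rw [← e]
    linarith [h a ha, G.opt_le hs q ha]

theorem opt_mono (G : Game S A) (s : S) {q q' : A → ℝ} (h : ∀ a ∈ G.act s, q a ≤ q' a) :
    G.opt s q ≤ G.opt s q' := by
  simpa using G.opt_le_opt_add s (d := 0) (by simpa using h)

theorem abs_opt_sub_opt_le (G : Game S A) (s : S) {q q' : A → ℝ} {d : ℝ}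
    (h : ∀ a ∈ G.act s, |q a - q' a| ≤ d) : |G.opt s q - G.opt s q'| ≤ d := by
  rw [abs_le]
  constructor
  · linarith [G.opt_le_opt_add s (q := q') (q' := q) (d := d)
      fun a ha => by linarith [(abs_le.1 (h a ha)).1]]
  · linarith [G.opt_le_opt_add s (q := q) (q' := q') (d := d)
      fun a ha => by linarith [(abs_le.1 (h a ha)).2]]

theorem flip_opt (G : Game S A) (s : S) (c : ℝ) (q : A → ℝ) :
    G.flip.opt s (fun a => c - q a) = c - G.opt s q := by
  by_cases hs : s ∈ G.maxStates
  · have hs' : s ∉ G.flip.maxStates := fun h => h hs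
    obtain ⟨a, ha, e⟩ := G.exists_eq_opt s q
    obtain ⟨b, hb, e'⟩ := G.flip.exists_eq_opt s (fun a => c - q a)
    have h1 := G.flip.opt_le hs' (fun a => c - q a) (a := a) ha
    have h2 := G.le_opt hs q hb
    beta_reduce at h1 e'
    linarith
  · have hs' : s ∈ G.flip.maxStates := hs
    obtain ⟨a, ha, e⟩ := G.exists_eq_opt s q
    obtain ⟨b, hb, e'⟩ := G.flip.exists_eq_opt s (fun a => c - q a)
    have h1 := G.flip.le_opt hs' (fun a => c - q a) (a := a) ha
    have h2 := G.opt_le hs q hb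
    beta_reduce at h1 e'
    linarith

theorem play_of_mem {G : Game S A} (π : G.Strategy) (π₂ : G.Strategy₂) {s : S} (hs : s ∈ G.maxStates) :
    G.play (π.1, π₂) s = G.play π s := by
  simp [play, hs]

theorem play_of_notMem {G : Game S A} (π : G.Strategy) (π₁ : G.Strategy₁) {s : S} (hs : s ∉ G.maxStates) :
    G.play (π₁, π.2) s = G.play π s := by
  simp [play, hs]

theorem one_sub_γ_pos (G : Game S A) : 0 < 1 - G.γ := sub_pos.2 G.γ_lt_one

/-! ### The Bellman operator -/

section Bellman

variable [Fintype S]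

/-- The value of playing `a` at `s` and continuing with `u`. -/
def qval (G : Game S A) (u : S → ℝ) (s : S) (a : A) : ℝ :=
  G.r s a + G.γ * expect (G.P s a) u

/-- The Bellman operator. -/
def bellman (G : Game S A) (u : S → ℝ) (s : S) : ℝ := G.opt s (G.qval u s)

theorem abs_qval_sub_qval_le (G : Game S A) {u w : S → ℝ} {d : ℝ} (h : ∀ s, |u s - w s| ≤ d)
    (s : S) (a : A) : |G.qval u s a - G.qval w s a| ≤ G.γ * d := by
  rw [qval, qval, add_sub_add_left_eq_sub, ← mul_sub, abs_mul, abs_of_nonneg G.γ_nonneg]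
  exact mul_le_mul_of_nonneg_left (abs_expect_sub_expect_le _ h) G.γ_nonneg

/-- The Bellman operator has a fixed point. -/
theorem exists_bellman_eq (G : Game S A) : ∃ v : S → ℝ, G.bellman v = v := by
  have hc : ContractingWith ⟨G.γ, G.γ_nonneg⟩ G.bellman := by
    refine ⟨by exact_mod_cast G.γ_lt_one, LipschitzWith.of_dist_le_mul fun u w => ?_⟩
    refine (dist_pi_le_iff (mul_nonneg G.γ_nonneg dist_nonneg)).2 fun s => ?_
    rw [Real.dist_eq]
    exact G.abs_opt_sub_opt_le s fun a _ => G.abs_qval_sub_qval_le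
      (fun t => by rw [← Real.dist_eq]; exact dist_le_pi_dist u w t) s a
  exact ⟨_, hc.fixedPoint_isFixedPt⟩

variable {G : Game S A} {v : S → ℝ}

theorem exists_qval_eq (hv : G.bellman v = v) (s : S) : ∃ a ∈ G.act s, G.qval v s a = v s := by
  obtain ⟨a, ha, h⟩ := G.exists_eq_opt s (G.qval v s)
  exact ⟨a, ha, h.trans (congrFun hv s)⟩

theorem qval_le_of_mem (hv : G.bellman v = v) {s : S} (hs : s ∈ G.maxStates) {a : A}
    (ha : a ∈ G.act s) : G.qval v s a ≤ v s :=
  (G.le_opt hs _ ha).trans (congrFun hv s).le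

theorem le_qval_of_notMem (hv : G.bellman v = v) {s : S} (hs : s ∉ G.maxStates) {a : A}
    (ha : a ∈ G.act s) : v s ≤ G.qval v s a :=
  (congrFun hv s).ge.trans (G.opt_le hs _ ha)

/-- At a state of the maximizer take an action optimal for `u`, at a state of the minimizer one
optimal for `v`. Along these actions `u - v` is dominated by its own discounted expectation, so its
maximum is not positive. -/
theorem le_of_le_bellman (hv : G.bellman v = v) {u : S → ℝ} (h : ∀ s, u s ≤ G.bellman u s)
    (s : S) : u s ≤ v s := by
  have key : ∀ s, ∃ a, u s - v s ≤ G.γ * expect (G.P s a) (fun t => u t - v t) + 0 := by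
    intro s
    by_cases hs : s ∈ G.maxStates
    · obtain ⟨a, ha, e⟩ := G.exists_eq_opt s (G.qval u s)
      refine ⟨a, ?_⟩
      have h1 := h s
      have h2 := qval_le_of_mem hv hs ha
      rw [bellman, ← e] at h1
      rw [expect_sub]
      unfold qval at h1 h2
      linarith
    · obtain ⟨a, ha, e⟩ := exists_qval_eq hv s
      refine ⟨a, ?_⟩
      have h1 := (h s).trans (G.opt_le hs _ ha)
      rw [expect_sub]
      unfold qval at h1 e
      linarith
  choose f hf using key
  simpa using le_div_of_le_discounted G.γ_nonneg G.γ_lt_one (fun s => G.P s (f s)) hf s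

theorem le_of_bellman_le (hv : G.bellman v = v) {u : S → ℝ} (h : ∀ s, G.bellman u s ≤ u s)
    (s : S) : v s ≤ u s := by
  have key : ∀ s, ∃ a, v s - u s ≤ G.γ * expect (G.P s a) (fun t => v t - u t) + 0 := by
    intro s
    by_cases hs : s ∈ G.maxStates
    · obtain ⟨a, ha, e⟩ := exists_qval_eq hv s
      refine ⟨a, ?_⟩
      have h1 := (G.le_opt hs _ ha).trans (h s)
      rw [expect_sub]
      unfold qval at h1 e
      linarith
    · obtain ⟨a, ha, e⟩ := G.exists_eq_opt s (G.qval u s)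
      refine ⟨a, ?_⟩
      have h1 := h s
      have h2 := le_qval_of_notMem hv hs ha
      rw [bellman, ← e] at h1
      rw [expect_sub]
      unfold qval at h1 h2
      linarith
  choose f hf using key
  simpa using le_div_of_le_discounted G.γ_nonneg G.γ_lt_one (fun s => G.P s (f s)) hf s

theorem bellman_nonneg (hv : G.bellman v = v) (s : S) : 0 ≤ v s := by
  refine le_of_le_bellman hv (u := fun _ => 0) (fun s => ?_) s
  obtain ⟨a, -, e⟩ := G.exists_eq_opt s (G.qval (fun _ => 0) s)
  rw [bellman, ← e, qval, expect_const]
  simpa using G.r_nonneg s a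

theorem bellman_le_inv (hv : G.bellman v = v) (s : S) : v s ≤ 1 / (1 - G.γ) := by
  refine le_of_bellman_le hv (u := fun _ => 1 / (1 - G.γ)) (fun s => ?_) s
  obtain ⟨a, -, e⟩ := G.exists_eq_opt s (G.qval (fun _ => 1 / (1 - G.γ)) s)
  rw [bellman, ← e, qval, expect_const]
  have := G.one_sub_γ_pos
  have h2 : 1 + G.γ * (1 / (1 - G.γ)) = 1 / (1 - G.γ) := by field_simp; ring
  linarith [G.r_le_one s a]

/-- The constant `c = 1 / (1 - γ)` solves `1 + γ * c = c`, so `u ↦ c - u` intertwines the two games.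
-/
theorem flip_qval (G : Game S A) (u : S → ℝ) (s : S) (a : A) :
    G.flip.qval (fun t => 1 / (1 - G.γ) - u t) s a = 1 / (1 - G.γ) - G.qval u s a := by
  have := G.one_sub_γ_pos
  have h2 : 1 + G.γ * (1 / (1 - G.γ)) = 1 / (1 - G.γ) := by field_simp; ring
  change 1 - G.r s a + G.γ * expect (G.P s a) (fun t => 1 / (1 - G.γ) - u t) = _
  rw [expect_sub, expect_const, qval]
  linarith

theorem flip_bellman_eq (hv : G.bellman v = v) :
    G.flip.bellman (fun t => 1 / (1 - G.γ) - v t) = fun t => 1 / (1 - G.γ) - v t := by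
  funext s
  have h : G.flip.qval (fun t => 1 / (1 - G.γ) - v t) s
      = fun a => 1 / (1 - G.γ) - G.qval v s a := funext fun a => G.flip_qval v s a
  rw [bellman, h, flip_opt, ← congrFun hv s]
  rfl

end Bellman

/-! ### Values of strategies -/

section Values

variable [Fintype S] [MeasurableSpace S] [MeasurableSingletonClass S]

instance (G : Game S A) (π : G.Strategy) (s : S) : IsProbabilityMeasure (G.trajLaw π s) :=
  inferInstanceAs (IsProbabilityMeasure
    (Kernel.trajMeasure (X := fun _ => S) (Measure.dirac s) (G.stepKernel π)))

/-- One step of the Markov chain of a strategy, acting on functions. -/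
def transition (G : Game S A) (π : G.Strategy) (f : S → ℝ) (s : S) : ℝ :=
  expect (G.P s (G.play π s)) f

theorem map_eval_zero_trajLaw (G : Game S A) (π : G.Strategy) (s : S) :
    (G.trajLaw π s).map (fun ω => ω 0) = Measure.dirac s := by
  have h : (G.trajLaw π s).map (Preorder.frestrictLe 0) =
      (Measure.dirac s).map (MeasurableEquiv.piUnique (fun _ : Finset.Iic 0 => S)).symm := by
    rw [trajLaw, Kernel.trajMeasure, Measure.map_comp _ _ (by fun_prop),
      Kernel.traj_map_frestrictLe, Kernel.partialTraj_self, Measure.id_comp]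
  have h2 := congrArg
    (Measure.map (fun x : Finset.Iic 0 → S => x ⟨0, Finset.mem_Iic.2 le_rfl⟩)) h
  rw [Measure.map_map (by fun_prop) (by fun_prop), Measure.map_map (by fun_prop) (by fun_prop)] at h2
  refine Eq.trans h2 ?_
  rw [Measure.map_dirac' (by fun_prop)]
  rfl

theorem integral_trajLaw_zero (G : Game S A) (π : G.Strategy) (f : S → ℝ) (s : S) :
    ∫ ω, f (ω 0) ∂(G.trajLaw π s) = f s := by
  have h := integral_map (μ := G.trajLaw π s) (φ := fun ω => ω 0) (f := f)
    (measurable_pi_apply 0).aemeasurable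
    (by rw [map_eval_zero_trajLaw]; exact .of_discrete)
  rw [← h, map_eval_zero_trajLaw, integral_dirac]

/-- The joint law of the history up to `n` and the next state disintegrates through `stepKernel`,
whose integral of `f` depends on the last state of the history only. -/
theorem integral_trajLaw_succ (G : Game S A) (π : G.Strategy) (f : S → ℝ) (s : S) (n : ℕ) :
    ∫ ω, f (ω (n + 1)) ∂(G.trajLaw π s) = ∫ ω, G.transition π f (ω n) ∂(G.trajLaw π s) := by
  have h : (G.trajLaw π s).map (Preorder.frestrictLe n) ⊗ₘ G.stepKernel π n =
      (G.trajLaw π s).map (fun x => (Preorder.frestrictLe n x, x (n + 1))) :=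
    Kernel.map_frestrictLe_trajMeasure_compProd_eq_map_trajMeasure
      (X := fun _ => S) (μ₀ := Measure.dirac s) (κ := G.stepKernel π) (a := n)
  have : IsProbabilityMeasure ((G.trajLaw π s).map (Preorder.frestrictLe (π := fun _ => S) n)) :=
    Measure.isProbabilityMeasure_map (by fun_prop)
  have h1 : ∫ x, f x.2 ∂((G.trajLaw π s).map
      (fun x => (Preorder.frestrictLe (π := fun _ => S) n x, x (n + 1)))) =
      ∫ ω, f (ω (n + 1)) ∂(G.trajLaw π s) :=
    integral_map (by fun_prop) .of_discrete
  rw [← h1, ← h, Measure.integral_compProd .of_finite, integral_map (by fun_prop) .of_discrete]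
  refine integral_congr_ae (.of_forall fun ω => ?_)
  exact integral_toMeasure _ f

theorem integral_trajLaw (G : Game S A) (π : G.Strategy) (s : S) (n : ℕ) (f : S → ℝ) :
    ∫ ω, f (ω n) ∂(G.trajLaw π s) = (G.transition π)^[n] f s := by
  induction n generalizing f with
  | zero => exact G.integral_trajLaw_zero π f s
  | succ n ih => rw [integral_trajLaw_succ, ih, Function.iterate_succ_apply]

/-- The value of a strategy is the discounted sum of the expected rewards. -/
theorem hasSum_value (G : Game S A) (π : G.Strategy) (s : S) :
    HasSum (fun n => G.γ ^ n * (G.transition π)^[n] (fun t => G.r t (G.play π t)) s)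
      (G.value π s) := by
  have hm : ∀ n, Measurable fun ω : ℕ → S => G.γ ^ n * G.r (ω n) (G.play π (ω n)) := fun n =>
    (Measurable.of_discrete (f := fun t => G.γ ^ n * G.r t (G.play π t))).comp
      (measurable_pi_apply n)
  have hb : ∀ n (ω : ℕ → S), ‖G.γ ^ n * G.r (ω n) (G.play π (ω n))‖ ≤ G.γ ^ n := fun n ω => by
    rw [Real.norm_of_nonneg (mul_nonneg (pow_nonneg G.γ_nonneg n) (G.r_nonneg _ _))]
    exact mul_le_of_le_one_right (pow_nonneg G.γ_nonneg n) (G.r_le_one _ _)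
  have hi : ∀ n, Integrable (fun ω : ℕ → S => G.γ ^ n * G.r (ω n) (G.play π (ω n)))
      (G.trajLaw π s) := fun n =>
    Integrable.of_bound (hm n).aestronglyMeasurable (G.γ ^ n) (.of_forall (hb n))
  have hs : Summable fun n => ∫ ω, ‖G.γ ^ n * G.r (ω n) (G.play π (ω n))‖ ∂(G.trajLaw π s) := by
    refine Summable.of_nonneg_of_le (fun n => integral_nonneg fun ω => norm_nonneg _) (fun n => ?_)
      (summable_geometric_of_lt_one G.γ_nonneg G.γ_lt_one)
    have := integral_mono (μ := G.trajLaw π s) (hi n).norm (integrable_const (G.γ ^ n)) (hb n)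
    simpa using this
  have he : ∀ n, ∫ ω, G.γ ^ n * G.r (ω n) (G.play π (ω n)) ∂(G.trajLaw π s) =
      G.γ ^ n * (G.transition π)^[n] (fun t => G.r t (G.play π t)) s := fun n => by
    rw [integral_const_mul, G.integral_trajLaw π s n fun t => G.r t (G.play π t)]
  simpa only [he] using! hasSum_integral_of_summable_integral_norm hi hs

/-- The Bellman equation of a fixed strategy. -/
theorem value_eq (G : Game S A) (π : G.Strategy) (s : S) :
    G.value π s = G.qval (G.value π) s (G.play π s) := by
  set R : S → ℝ := fun t => G.r t (G.play π t)
  -- Conditioning on the first step: the reward series without its initial term is `γ` times the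
  -- expected value at the next state.
  have h1 : HasSum (fun n => G.γ ^ (n + 1) * (G.transition π)^[n + 1] R s)
      (G.γ * expect (G.P s (G.play π s)) (G.value π)) := by
    have h2 : HasSum (fun n => G.γ * ∑ t, (G.P s (G.play π s) t).toReal *
        (G.γ ^ n * (G.transition π)^[n] R t)) (G.γ * expect (G.P s (G.play π s)) (G.value π)) :=
      (hasSum_sum fun t _ => (G.hasSum_value π t).mul_left _).mul_left _
    convert h2 using 2 with n
    rw [Function.iterate_succ_apply', transition, expect, pow_succ', mul_assoc, Finset.mul_sum]
    congr 1
    exact Finset.sum_congr rfl fun t _ => by ring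
  have h3 := (hasSum_nat_add_iff' 1).2 (G.hasSum_value π s)
  have h4 := h3.unique h1
  simp only [Finset.range_one, Finset.sum_singleton, pow_zero, one_mul,
    Function.iterate_zero, id] at h4
  rw [qval]
  linarith

variable {G : Game S A}

/-- A function that is dominated by playing `π` for one step and continuing with the function itself
is a lower bound of the value of `π`. -/
theorem le_value_add {π : G.Strategy} {u : S → ℝ} {e : ℝ}
    (h : ∀ s, u s ≤ G.qval u s (G.play π s) + e) (s : S) :
    u s ≤ G.value π s + e / (1 - G.γ) := by
  have := le_div_of_le_discounted G.γ_nonneg G.γ_lt_one (fun s => G.P s (G.play π s))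
    (u := fun t => u t - G.value π t) (e := e) (fun t => by
      have h1 := h t
      have h2 := G.value_eq π t
      rw [expect_sub]
      unfold qval at h1 h2
      linarith) s
  linarith

theorem value_le_add {π : G.Strategy} {u : S → ℝ} {e : ℝ}
    (h : ∀ s, G.qval u s (G.play π s) ≤ u s + e) (s : S) :
    G.value π s ≤ u s + e / (1 - G.γ) := by
  have := le_div_of_le_discounted G.γ_nonneg G.γ_lt_one (fun s => G.P s (G.play π s))
    (u := fun t => G.value π t - u t) (e := e) (fun t => by
      have h1 := h t
      have h2 := G.value_eq π t
      rw [expect_sub]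
      unfold qval at h1 h2
      linarith) s
  linarith

/-- Only the choices of player 1 are tied to `π`; at the other states the inequality is required for
all available actions, so that it survives any deviation of player 2. -/
theorem le_value_deviation {π : G.Strategy} {u : S → ℝ} {e : ℝ}
    (hmax : ∀ s ∈ G.maxStates, u s ≤ G.qval u s (G.play π s) + e)
    (hmin : ∀ s ∉ G.maxStates, ∀ a ∈ G.act s, u s ≤ G.qval u s a + e)
    (π₂ : G.Strategy₂) (s : S) : u s ≤ G.value (π.1, π₂) s + e / (1 - G.γ) := by
  refine le_value_add (fun t => ?_) s
  by_cases ht : t ∈ G.maxStates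
  · rw [play_of_mem π π₂ ht]
    exact hmax t ht
  · exact hmin t ht _ (G.play_mem _ t)

theorem value_deviation_le {π : G.Strategy} {u : S → ℝ} {e : ℝ}
    (hmax : ∀ s ∈ G.maxStates, ∀ a ∈ G.act s, G.qval u s a ≤ u s + e)
    (hmin : ∀ s ∉ G.maxStates, G.qval u s (G.play π s) ≤ u s + e)
    (π₁ : G.Strategy₁) (s : S) : G.value (π₁, π.2) s ≤ u s + e / (1 - G.γ) := by
  refine value_le_add (fun t => ?_) s
  by_cases ht : t ∈ G.maxStates
  · exact hmax t ht _ (G.play_mem _ t)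
  · rw [play_of_notMem π π₁ ht]
    exact hmin t ht

/-- A fixed point of the Bellman operator is an equilibrium value. -/
theorem isEquilibriumValue_of_bellman_eq {v : S → ℝ} (hv : G.bellman v = v) :
    G.IsEquilibriumValue v := by
  choose f hf h using exists_qval_eq hv
  obtain ⟨π, hπ⟩ := G.exists_play f hf
  have hplay : ∀ s, G.qval v s (G.play π s) = v s := fun s => by rw [hπ, h]
  have hval : G.value π = v := by
    funext s
    have h1 := le_value_add (π := π) (u := v) (e := 0) (fun t => by simp [hplay]) s
    have h2 := value_le_add (π := π) (u := v) (e := 0) (fun t => by simp [hplay]) s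
    rw [zero_div, add_zero] at h1 h2
    exact le_antisymm h2 h1
  refine ⟨π, ⟨fun π₁ s => ?_, fun π₂ s => ?_⟩, hval⟩
  · rw [hval]
    simpa using value_deviation_le (π := π) (u := v) (e := 0)
      (fun t ht a ha => by simpa using qval_le_of_mem hv ht ha) (fun t _ => by simp [hplay]) π₁ s
  · rw [hval]
    simpa using le_value_deviation (π := π) (u := v) (e := 0) (fun t _ => by simp [hplay])
      (fun t ht a ha => by simpa using le_qval_of_notMem hv ht ha) π₂ s

theorem exists_isNash (G : Game S A) : ∃ π : G.Strategy, G.IsNash π := by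
  obtain ⟨v, hv⟩ := G.exists_bellman_eq
  obtain ⟨π, hπ, -⟩ := isEquilibriumValue_of_bellman_eq hv
  exact ⟨π, hπ⟩

/-! ### Perturbation of the transition probabilities -/

/-- The game with different transition probabilities. -/
def withTransitions (G : Game S A) (P' : S → A → PMF S) : Game S A := { G with P := P' }

theorem value_nonneg (π : G.Strategy) (s : S) : 0 ≤ G.value π s := by
  simpa using le_value_add (π := π) (u := fun _ => 0) (e := 0) (fun t => by
    rw [qval, expect_const]
    simpa using G.r_nonneg t _) s

theorem value_le_inv (π : G.Strategy) (s : S) : G.value π s ≤ 1 / (1 - G.γ) := by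
  simpa using value_le_add (π := π) (u := fun _ => 0) (e := 1) (fun t => by
    rw [qval, expect_const]
    simpa using G.r_le_one t _) s

/-- The value in the old model nearly solves the fixed-strategy equation of the new one. One factor
`1 / (1 - γ)` of the bound is the size of the value, the other comes from summing the one-step
residual over time. -/
theorem abs_value_sub_value_withTransitions_le {P' : S → A → PMF S} {ξ : ℝ}
    (hξ : ∀ s a, tvDist (G.P s a) (P' s a) ≤ ξ) (π : G.Strategy) (s : S) :
    |G.value π s - (G.withTransitions P').value π s| ≤ ξ / (1 - G.γ) ^ 2 := by
  have hγ := G.one_sub_γ_pos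
  have hb : ∀ t, |G.value π t| ≤ 1 / (1 - G.γ) := fun t => by
    rw [abs_of_nonneg (value_nonneg π t)]
    exact value_le_inv π t
  have key : ∀ t, |G.qval (G.value π) t (G.play π t) -
      (G.withTransitions P').qval (G.value π) t (G.play π t)| ≤ ξ / (1 - G.γ) := fun t => by
    change |G.r t (G.play π t) + _ -
      (G.r t (G.play π t) + G.γ * expect (P' t (G.play π t)) (G.value π))| ≤ _
    rw [add_sub_add_left_eq_sub, ← mul_sub, abs_mul, abs_of_nonneg G.γ_nonneg]
    have h1 := abs_expect_sub_expect_le_tvDist (G.P t (G.play π t)) (P' t (G.play π t)) hb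
    have h2 : tvDist (G.P t (G.play π t)) (P' t (G.play π t)) * (1 / (1 - G.γ)) ≤
        ξ / (1 - G.γ) := by
      rw [mul_one_div]
      exact div_le_div_of_nonneg_right (hξ _ _) hγ.le
    calc _ ≤ 1 * _ := mul_le_mul_of_nonneg_right G.γ_lt_one.le (abs_nonneg _)
      _ ≤ _ := by rw [one_mul]; exact h1.trans h2
  have e1 : ∀ t, G.value π t = G.qval (G.value π) t (G.play π t) := G.value_eq π
  have h1 := le_value_add (G := G.withTransitions P') (π := π) (u := G.value π)
    (e := ξ / (1 - G.γ)) (fun t => by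
      have := (abs_le.1 (key t)).2
      rw [← e1] at this
      change _ ≤ (G.withTransitions P').qval (G.value π) t (G.play π t) + _
      linarith) s
  have h2 := value_le_add (G := G.withTransitions P') (π := π) (u := G.value π)
    (e := ξ / (1 - G.γ)) (fun t => by
      have := (abs_le.1 (key t)).1
      rw [← e1] at this
      change (G.withTransitions P').qval (G.value π) t (G.play π t) ≤ _
      linarith) s
  have e2 : ξ / (1 - G.γ) / (1 - G.γ) = ξ / (1 - G.γ) ^ 2 := by field_simp
  change _ ≤ _ + ξ / (1 - G.γ) / (1 - G.γ) at h1
  change _ ≤ _ + ξ / (1 - G.γ) / (1 - G.γ) at h2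
  rw [e2] at h1 h2
  rw [abs_le]
  constructor <;> linarith

/-- Near-optimality is stable under perturbations of the transition probabilities. -/
theorem IsOptimalUpTo.of_withTransitions {P' : S → A → PMF S} {ξ ε : ℝ}
    (hξ : ∀ s a, tvDist (G.P s a) (P' s a) ≤ ξ) {π : G.Strategy}
    (h : (G.withTransitions P').IsOptimalUpTo ε π) :
    G.IsOptimalUpTo (2 * ξ / (1 - G.γ) ^ 2 + ε) π := by
  obtain ⟨v', ⟨σ', ⟨hσ'₁, hσ'₂⟩, rfl⟩, hopt⟩ := h
  obtain ⟨σ, hσ₁, hσ₂⟩ := G.exists_isNash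
  refine ⟨G.value σ, ⟨σ, ⟨hσ₁, hσ₂⟩, rfl⟩, fun s => ?_⟩
  set W : G.Strategy → S → ℝ := (G.withTransitions P').value
  have hd : ∀ τ : G.Strategy, -(ξ / (1 - G.γ) ^ 2) ≤ G.value τ s - W τ s ∧
      G.value τ s - W τ s ≤ ξ / (1 - G.γ) ^ 2 := fun τ =>
    abs_le.1 (abs_value_sub_value_withTransitions_le hξ τ s)
  have e2 : 2 * ξ / (1 - G.γ) ^ 2 = ξ / (1 - G.γ) ^ 2 + ξ / (1 - G.γ) ^ 2 := by ring
  -- The equilibria `σ` and `σ'` of the two models are compared through a hybrid pair, `(σ'.1, σ.2)`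
  -- or `(σ.1, σ'.2)`, for which both equilibrium inequalities point in the useful direction.
  refine ⟨fun π₁ => ?_, fun π₂ => ?_⟩
  · have h1 : W (π₁, π.2) s - W σ' s ≤ ε := (hopt s).1 π₁
    have h2 : G.value (σ'.1, σ.2) s ≤ G.value σ s := hσ₁ σ'.1 s
    have h3 : W σ' s ≤ W (σ'.1, σ.2) s := hσ'₂ σ.2 s
    linarith [(hd (π₁, π.2)).2, (hd (σ'.1, σ.2)).1]
  · have h1 : -ε ≤ W (π.1, π₂) s - W σ' s := (hopt s).2 π₂
    have h2 : G.value σ s ≤ G.value (σ.1, σ'.2) s := hσ₂ σ'.2 s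
    have h3 : W (σ.1, σ'.2) s ≤ W σ' s := hσ'₁ σ.1 s
    linarith [(hd (π.1, π₂)).1, (hd (σ.1, σ'.2)).2]

end Values

end Game

/-! ### Probabilities of bad events -/

section PMFLemmas

variable {α β : Type*}

theorem toOuterMeasure_le_one (p : PMF α) (s : Set α) : p.toOuterMeasure s ≤ 1 := by
  rw [PMF.toOuterMeasure_apply, ← p.tsum_coe]
  exact ENNReal.tsum_le_tsum fun x => Set.indicator_le_self s p x

/-- The union bound for consecutive random stages: failure probabilities add up, where the second
stage is judged only from good outcomes of the first. Outer measures avoid any measurability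
question on the space of parameters. -/
theorem toOuterMeasure_bind_compl_le {p : PMF α} {f : α → PMF β} {s : Set α} {t : Set β}
    {a b : ENNReal} (hs : p.toOuterMeasure sᶜ ≤ a) (h : ∀ x ∈ s, (f x).toOuterMeasure tᶜ ≤ b) :
    (p.bind f).toOuterMeasure tᶜ ≤ a + b := by
  rw [PMF.toOuterMeasure_bind_apply]
  calc ∑' x, p x * (f x).toOuterMeasure tᶜ
      ≤ ∑' x, (sᶜ.indicator p x + p x * b) := by
        refine ENNReal.tsum_le_tsum fun x => ?_
        by_cases hx : x ∈ s
        · exact le_add_left (mul_le_mul_right (h x hx) _)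
        · rw [Set.indicator_of_mem hx]
          exact le_add_right (mul_le_of_le_one_right zero_le (toOuterMeasure_le_one _ _))
    _ = p.toOuterMeasure sᶜ + b := by
        rw [ENNReal.tsum_add, ENNReal.tsum_mul_right, p.tsum_coe, one_mul,
          PMF.toOuterMeasure_apply]
    _ ≤ a + b := add_le_add_left hs b

theorem toOuterMeasure_map_compl_le {p : PMF α} {f : α → β} {s : Set α} {t : Set β}
    {a : ENNReal} (hs : p.toOuterMeasure sᶜ ≤ a) (h : ∀ x ∈ s, f x ∈ t) :
    (p.map f).toOuterMeasure tᶜ ≤ a := by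
  rw [PMF.toOuterMeasure_map_apply]
  refine le_trans (measure_mono ?_) hs
  intro x hx hxs
  exact hx (h x hxs)

theorem toOuterMeasure_pure_compl {a : α} {t : Set α} (h : a ∈ t) :
    (PMF.pure a).toOuterMeasure tᶜ = 0 := by
  simp [PMF.toOuterMeasure_pure_apply, h]

theorem ofReal_one_sub_le_toOuterMeasure {p : PMF α} {s : Set α} {x : ℝ} (hx : 0 ≤ x)
    (h : p.toOuterMeasure sᶜ ≤ ENNReal.ofReal x) :
    ENNReal.ofReal (1 - x) ≤ p.toOuterMeasure s := by
  have h1 : p.toOuterMeasure Set.univ = 1 :=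
    (p.toOuterMeasure_apply_eq_one_iff _).2 (Set.subset_univ _)
  rw [ENNReal.ofReal_sub _ hx, ENNReal.ofReal_one, tsub_le_iff_right]
  calc 1 = p.toOuterMeasure (s ∪ sᶜ) := by rw [Set.union_compl_self, h1]
    _ ≤ p.toOuterMeasure s + p.toOuterMeasure sᶜ := measure_union_le _ _
    _ ≤ _ := add_le_add_right h _

end PMFLemmas

/-! ### Concentration of the sample averages -/

section Sampling

variable [Fintype S] [MeasurableSpace S] [MeasurableSingletonClass S]

/-- Two-sided Hoeffding inequality for the average of `n` independent samples from `p`. -/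
theorem measure_average_deviation_le (p : PMF S) {n : ℕ} (hn : 0 < n) {f : S → ℝ} {b t κ : ℝ}
    (hb : 0 < b) (ht : 0 ≤ t) (hf : ∀ s, f s ∈ Set.Icc 0 b) (hκ : b ^ 2 * κ ≤ 2 * n * t ^ 2) :
    (Measure.pi fun _ : Fin n => p.toMeasure)
      {x | t < |(1 / (n : ℝ)) * ∑ i, f (x i) - expect p f|} ≤
        ENNReal.ofReal (2 * Real.exp (-κ)) := by
  set μ := Measure.pi fun _ : Fin n => p.toMeasure
  have hn' : (0 : ℝ) < n := by exact_mod_cast hn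
  have hsub : HasSubgaussianMGF (fun s => f s - expect p f) ((‖b - 0‖₊ / 2) ^ 2) p.toMeasure := by
    rw [← integral_toMeasure]
    exact hasSubgaussianMGF_of_mem_Icc (Measurable.of_discrete).aemeasurable (.of_forall hf)
  have key : ∀ g : S → ℝ, HasSubgaussianMGF g ((‖b - 0‖₊ / 2) ^ 2) p.toMeasure →
      μ {x | n * t ≤ ∑ i, g (x i)} ≤ ENNReal.ofReal (Real.exp (-κ)) := by
    intro g hg
    have hind : iIndepFun (fun (i : Fin n) (x : Fin n → S) => g (x i)) μ :=
      iIndepFun_pi (X := fun _ : Fin n => g) fun _ => (Measurable.of_discrete).aemeasurable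
    have hgi : ∀ i ∈ (Finset.univ : Finset (Fin n)),
        HasSubgaussianMGF (fun x : Fin n → S => g (x i)) ((‖b - 0‖₊ / 2) ^ 2) μ := fun i _ => by
      have hm : μ.map (Function.eval i) = p.toMeasure :=
        (measurePreserving_eval (fun _ : Fin n => p.toMeasure) i).map_eq
      rw [← hm] at hg
      exact HasSubgaussianMGF.of_map (measurable_pi_apply i).aemeasurable hg
    have h := HasSubgaussianMGF.measure_sum_ge_le_of_iIndepFun hind hgi
      (mul_nonneg hn'.le ht)
    rw [← ofReal_measureReal]
    refine ENNReal.ofReal_le_ofReal (h.trans (Real.exp_le_exp.2 ?_))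
    simp only [Finset.sum_const, Finset.card_univ, Fintype.card_fin, nsmul_eq_mul, sub_zero,
      NNReal.coe_mul, NNReal.coe_natCast, NNReal.coe_pow, NNReal.coe_div, coe_nnnorm,
      NNReal.coe_ofNat, Real.norm_of_nonneg hb.le]
    -- The sum of `n` terms has variance proxy `n * (b / 2) ^ 2`, so the exponent at level `n * t`
    -- is `2 * n * t ^ 2 / b ^ 2`.
    rw [neg_div, neg_le_neg_iff, le_div_iff₀ (by positivity)]
    nlinarith [mul_le_mul_of_nonneg_left hκ hn'.le]
  have h1 := key _ hsub
  have h2 := key _ hsub.neg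
  have hsum : ∀ x : Fin n → S, ∑ i, (f (x i) - expect p f) =
      n * ((1 / (n : ℝ)) * ∑ i, f (x i) - expect p f) := fun x => by
    rw [Finset.sum_sub_distrib, Finset.sum_const, Finset.card_univ, Fintype.card_fin,
      nsmul_eq_mul]
    field_simp
  have hsubset : {x : Fin n → S | t < |(1 / (n : ℝ)) * ∑ i, f (x i) - expect p f|} ⊆
      {x | n * t ≤ ∑ i, (f (x i) - expect p f)} ∪
      {x | n * t ≤ ∑ i, (-fun s => f s - expect p f) (x i)} := by
    intro x hx
    rw [Set.mem_ofPred_eq] at hx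
    rcases lt_abs.1 hx with h | h
    · left
      rw [Set.mem_ofPred_eq, hsum]
      exact mul_le_mul_of_nonneg_left h.le hn'.le
    · right
      simp only [Set.mem_ofPred_eq, Pi.neg_apply]
      rw [Finset.sum_neg_distrib, hsum, ← mul_neg]
      exact mul_le_mul_of_nonneg_left h.le hn'.le
  refine (measure_mono hsubset).trans ((measure_union_le _ _).trans ((add_le_add h1 h2).trans ?_))
  rw [← ENNReal.ofReal_add (Real.exp_pos _).le (Real.exp_pos _).le, two_mul]

theorem draws_deviation_le (P : S → A → PMF S) (anchor : Fin K → S × A) {n : ℕ} (hn : 0 < n)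
    {f : S → ℝ} {b t κ : ℝ} (hb : 0 < b) (ht : 0 ≤ t) (hf : ∀ s, f s ∈ Set.Icc 0 b)
    (hκ : b ^ 2 * κ ≤ 2 * n * t ^ 2) :
    (draws P anchor n).toOuterMeasure
      {x | ∀ k, |(1 / (n : ℝ)) * ∑ i, f (x k i) - expect (P (anchor k).1 (anchor k).2) f| ≤ t}ᶜ ≤
        ENNReal.ofReal (K * (2 * Real.exp (-κ))) := by
  rw [← PMF.toMeasure_apply_eq_toOuterMeasure, draws, Measure.toPMF_toMeasure]
  set p : Fin K → PMF S := fun k => P (anchor k).1 (anchor k).2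
  set μ := Measure.pi fun k : Fin K => Measure.pi fun _ : Fin n => (p k).toMeasure
  have hsubset : {x : Fin K → Fin n → S |
      ∀ k, |(1 / (n : ℝ)) * ∑ i, f (x k i) - expect (p k) f| ≤ t}ᶜ ⊆
      ⋃ k, Function.eval k ⁻¹'
        {y : Fin n → S | t < |(1 / (n : ℝ)) * ∑ i, f (y i) - expect (p k) f|} := by
    intro x hx
    simp only [Set.mem_compl_iff, Set.mem_ofPred_eq, not_forall, not_le] at hx
    simpa using! hx
  refine (measure_mono hsubset).trans ((measure_iUnion_fintype_le _ _).trans ?_)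
  have hk : ∀ k, μ (Function.eval k ⁻¹'
        {y : Fin n → S | t < |(1 / (n : ℝ)) * ∑ i, f (y i) - expect (p k) f|}) ≤
      ENNReal.ofReal (2 * Real.exp (-κ)) := fun k => by
    rw [(measurePreserving_eval (fun k => Measure.pi fun _ : Fin n => (p k).toMeasure)
      k).measure_preimage (MeasurableSet.of_discrete).nullMeasurableSet]
    exact measure_average_deviation_le (p k) hn hb ht hf hκ
  refine (Finset.sum_le_sum fun k _ => hk k).trans ?_
  rw [Finset.sum_const, Finset.card_univ, Fintype.card_fin, nsmul_eq_mul,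
    ENNReal.ofReal_mul (Nat.cast_nonneg K), ENNReal.ofReal_natCast]

/-! ### The algorithms depend on the transition probabilities at the anchor pairs only -/

theorem draws_congr {P P' : S → A → PMF S} {anchor : Fin K → S × A}
    (h : ∀ k, P (anchor k).1 (anchor k).2 = P' (anchor k).1 (anchor k).2) (n : ℕ) :
    draws P anchor n = draws P' anchor n := by
  refine PMF.ext fun x => ?_
  simp only [draws, Measure.toPMF_apply, h]

variable {G : Game S A} {φ : S → A → Fin K → ℝ} {anchor : Fin K → S × A} {P' : S → A → PMF S}

theorem basicIterate_withTransitions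
    (h : ∀ k, G.P (anchor k).1 (anchor k).2 = P' (anchor k).1 (anchor k).2) (T t : ℕ) :
    basicIterate (G.withTransitions P') φ anchor T t = basicIterate G φ anchor T t := by
  induction t with
  | zero => rfl
  | succ t ih =>
    rw [basicIterate, basicIterate, ih, draws_congr h]
    rfl

theorem vrInnerLoop_withTransitions
    (h : ∀ k, G.P (anchor k).1 (anchor k).2 = P' (anchor k).1 (anchor k).2) (m₁ : ℕ) (e : ℝ)
    (θ₀ : Params K) (M₀ : Fin K → ℝ) (j : ℕ) :
    vrInnerLoop (G.withTransitions P') φ anchor m₁ e θ₀ M₀ j =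
      vrInnerLoop G φ anchor m₁ e θ₀ M₀ j := by
  induction j with
  | zero => rfl
  | succ j ih =>
    rw [vrInnerLoop, vrInnerLoop, ih, draws_congr h]
    rfl

theorem vrOuterLoop_withTransitions
    (h : ∀ k, G.P (anchor k).1 (anchor k).2 = P' (anchor k).1 (anchor k).2) (m m₁ R : ℕ)
    (e : ℕ → ℝ) (i : ℕ) :
    vrOuterLoop (G.withTransitions P') φ anchor m m₁ R e i =
      vrOuterLoop G φ anchor m m₁ R e i := by
  induction i with
  | zero => rfl
  | succ i ih =>
    simp only [vrOuterLoop, ih, vrInnerLoop_withTransitions h, draws_congr h]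
    rfl

theorem basicAlgorithm_withTransitions
    (h : ∀ k, G.P (anchor k).1 (anchor k).2 = P' (anchor k).1 (anchor k).2) (cR cT L ε δ : ℝ) :
    basicAlgorithm cR cT (G.withTransitions P') φ anchor L ε δ =
      basicAlgorithm cR cT G φ anchor L ε δ :=
  basicIterate_withTransitions h _ _

theorem oneSidedAlgorithm_withTransitions
    (h : ∀ k, G.P (anchor k).1 (anchor k).2 = P' (anchor k).1 (anchor k).2) (c : VRConst)
    (L ε δ : ℝ) :
    oneSidedAlgorithm c (G.withTransitions P') φ anchor L ε δ =
      oneSidedAlgorithm c G φ anchor L ε δ :=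
  vrOuterLoop_withTransitions h _ _ _ _ _

theorem twoSidedAlgorithm_withTransitions
    (h : ∀ k, G.P (anchor k).1 (anchor k).2 = P' (anchor k).1 (anchor k).2) (c : VRConst)
    (L ε δ : ℝ) :
    twoSidedAlgorithm c (G.withTransitions P') φ anchor L ε δ =
      twoSidedAlgorithm c G φ anchor L ε δ := by
  have h2 : oneSidedAlgorithm c (G.withTransitions P').flip φ anchor L ε δ =
      oneSidedAlgorithm c G.flip φ anchor L ε δ :=
    oneSidedAlgorithm_withTransitions (G := G.flip) h c L ε δ
  rw [twoSidedAlgorithm, twoSidedAlgorithm, oneSidedAlgorithm_withTransitions h, h2]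

end Sampling

/-! ### Linear extrapolation from the anchor pairs -/

section Extrapolation

variable [Fintype S] {P : S → A → PMF S} {φ : S → A → Fin K → ℝ} {anchor : Fin K → S × A}

/-- The embedding gives `expect (P s a) h = φ s a ⬝ᵥ c` with `c` independent of `(s, a)`; the values
at the anchor pairs form the invertible system that recovers `c`. -/
theorem expect_eq_extrapolation (hP : Embeds P φ) (hdet : IsUnit (anchorMatrix φ anchor).det)
    (h : S → ℝ) (s : S) (a : A) :
    expect (P s a) h = φ s a ⬝ᵥ ((anchorMatrix φ anchor)⁻¹ *ᵥ
      fun k => expect (P (anchor k).1 (anchor k).2) h) := by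
  obtain ⟨ψ, hψ⟩ := hP
  have hE : ∀ s a, expect (P s a) h = φ s a ⬝ᵥ fun k => ∑ t, ψ k t * h t := fun s a => by
    simp only [expect, hψ, dotProduct, Finset.sum_mul, Finset.mul_sum, mul_assoc]
    exact Finset.sum_comm
  have hA : (fun k => expect (P (anchor k).1 (anchor k).2) h) =
      anchorMatrix φ anchor *ᵥ fun k => ∑ t, ψ k t * h t := funext fun k => hE _ _
  rw [hA, Matrix.mulVec_mulVec, Matrix.nonsing_inv_mul _ hdet, Matrix.one_mulVec, hE]

theorem abs_dotProduct_le {φ w : Fin K → ℝ} {c : ℝ} (h : ∀ k, |w k| ≤ c) :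
    |φ ⬝ᵥ w| ≤ (∑ k, |φ k|) * c := by
  rw [dotProduct, Finset.sum_mul]
  refine (Finset.abs_sum_le_sum_abs _ _).trans (Finset.sum_le_sum fun k _ => ?_)
  rw [abs_mul]
  exact mul_le_mul_of_nonneg_left (h k) (abs_nonneg _)

/-- The factor `∑ k, |φ s a k|` is kept rather than bounded by `1`, since the downward shift of the
one-sided algorithm has to be compared with it exactly. -/
theorem abs_extrapolation_sub_expect_le {L t : ℝ} (hP : Embeds P φ)
    (hdet : IsUnit (anchorMatrix φ anchor).det)
    (hL : ∀ k, ∑ j, |(anchorMatrix φ anchor)⁻¹ k j| ≤ L) (ht : 0 ≤ t) {h : S → ℝ} {M : Fin K → ℝ}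
    (hM : ∀ k, |M k - expect (P (anchor k).1 (anchor k).2) h| ≤ t) (s : S) (a : A) :
    |φ s a ⬝ᵥ ((anchorMatrix φ anchor)⁻¹ *ᵥ M) - expect (P s a) h| ≤
      (∑ k, |φ s a k|) * (L * t) := by
  rw [expect_eq_extrapolation hP hdet, ← dotProduct_sub, ← Matrix.mulVec_sub]
  exact abs_dotProduct_le fun k => (abs_dotProduct_le hM).trans
    (mul_le_mul_of_nonneg_right (hL k) ht)

/-- With a single anchor pair, the extrapolation is constant. -/
theorem extrapolation_one {φ : S → A → Fin 1 → ℝ} {anchor : Fin 1 → S × A} (hP : Embeds P φ)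
    (hdet : IsUnit (anchorMatrix φ anchor).det) (M : Fin 1 → ℝ) (s : S) (a : A) :
    φ s a ⬝ᵥ ((anchorMatrix φ anchor)⁻¹ *ᵥ M) = M 0 := by
  have h := expect_eq_extrapolation hP hdet (fun _ => M 0) s a
  simp only [expect_const] at h
  rw [h]
  congr 2
  funext k
  rw [Subsingleton.elim k 0]

end Extrapolation

/-! ### Exponential estimates and consequences of the embedding -/

theorem pow_le_exp_neg {γ : ℝ} (h0 : 0 ≤ γ) (n : ℕ) : γ ^ n ≤ Real.exp (-((1 - γ) * n)) := by
  have h : γ ≤ Real.exp (-(1 - γ)) := by linarith [Real.add_one_le_exp (-(1 - γ))]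
  calc γ ^ n ≤ Real.exp (-(1 - γ)) ^ n := pow_le_pow_left₀ h0 h n
    _ = Real.exp (-((1 - γ) * n)) := by rw [← Real.exp_nat_mul]; ring_nf

theorem exp_neg_nat_mul_log (n : ℕ) {x : ℝ} (hx : 0 < x) :
    Real.exp (-(n * Real.log (1 / x))) = x ^ n := by
  rw [one_div, Real.log_inv, mul_neg, neg_neg, Real.exp_nat_mul, Real.exp_log hx]

theorem isEmpty_of_embeds [Fintype S] {P : S → A → PMF S} {φ : S → A → Fin 0 → ℝ}
    (h : Embeds P φ) (s : S) (a : A) : False := by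
  obtain ⟨ψ, hψ⟩ := h
  have := sum_toReal (P s a)
  simp [hψ] at this

theorem AnchorCondition.abs_sub_le [Fintype S] {G : Game S A} {φ : S → A → Fin K → ℝ}
    {anchor : Fin K → S × A} {L t : ℝ} (h : AnchorCondition G φ anchor L) (hP : Embeds G.P φ)
    (hL : 0 ≤ L) (ht : 0 ≤ t) {f : S → ℝ} {M : Fin K → ℝ}
    (hM : ∀ k, |M k - expect (G.P (anchor k).1 (anchor k).2) f| ≤ t) {s : S} {a : A}
    (ha : a ∈ G.act s) :
    |φ s a ⬝ᵥ ((anchorMatrix φ anchor)⁻¹ *ᵥ M) - expect (G.P s a) f| ≤ L * t :=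
  (abs_extrapolation_sub_expect_le hP h.2.1 h.2.2 ht hM s a).trans
    (mul_le_of_le_one_left (mul_nonneg hL ht) (h.1 s a ha))

/-! ### Sampled value iteration -/

theorem clip_mem_Icc (G : Game S A) (x : ℝ) : clip G.γ x ∈ Set.Icc 0 (1 / (1 - G.γ)) := by
  have := one_div_pos.2 G.one_sub_γ_pos
  exact ⟨le_max_left _ _, max_le this.le (min_le_right _ _)⟩

/-- The projection is nonexpansive and fixes `y`. -/
theorem abs_clip_sub_le {γ x y d : ℝ} (hy : y ∈ Set.Icc 0 (1 / (1 - γ))) (h : |x - y| ≤ d) :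
    |clip γ x - y| ≤ d := by
  have hy' : clip γ y = y := by rw [clip, min_eq_left hy.2, max_eq_right hy.1]
  have hd : 0 ≤ d := (abs_nonneg _).trans h
  have h1 : |clip γ x - clip γ y| ≤ _ :=
    abs_max_sub_max_le_max 0 (min x (1 / (1 - γ))) 0 (min y (1 / (1 - γ)))
  have h2 := abs_min_sub_min_le_max x (1 / (1 - γ)) y (1 / (1 - γ))
  rw [hy'] at h1
  exact h1.trans (max_le (by simpa using hd) (h2.trans (max_le h (by simpa using hd))))

section Basic

variable [Fintype S] {G : Game S A} {φ : S → A → Fin K → ℝ} {v : S → ℝ}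

/-- The action values of `w` are within `d` of those of `v`. -/
def NearOptimalQ (G : Game S A) (φ : S → A → Fin K → ℝ) (v : S → ℝ) (d : ℝ) (w : Fin K → ℝ) :
    Prop :=
  ∀ s, ∀ a ∈ G.act s, |Q G φ w s a - G.qval v s a| ≤ d

theorem NearOptimalQ.abs_V_sub_le (hv : G.bellman v = v) {d : ℝ} {w : Fin K → ℝ}
    (h : NearOptimalQ G φ v d w) (s : S) : |V G φ w s - v s| ≤ d := by
  rw [← congrFun hv s]
  exact G.abs_opt_sub_opt_le s (h s)

theorem nearOptimalQ_zero (hv : G.bellman v = v) :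
    NearOptimalQ G φ v (G.γ / (1 - G.γ)) 0 := by
  intro s a _
  have h0 := le_expect (G.P s a) (Game.bellman_nonneg hv)
  have h1 := expect_le (G.P s a) (Game.bellman_le_inv hv)
  rw [Q, Game.qval, dotProduct_zero, mul_zero, add_zero, sub_add_cancel_left, abs_neg, abs_mul,
    abs_of_nonneg G.γ_nonneg, abs_of_nonneg h0, ← mul_one_div]
  exact mul_le_mul_of_nonneg_left h1 G.γ_nonneg

theorem NearOptimalQ.step (hv : G.bellman v = v) {d η : ℝ} {w w' : Fin K → ℝ}
    (h : NearOptimalQ G φ v d w)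
    (h' : ∀ s, ∀ a ∈ G.act s,
      |φ s a ⬝ᵥ w' - expect (G.P s a) (fun t => clip G.γ (V G φ w t))| ≤ η) :
    NearOptimalQ G φ v (G.γ * (d + η)) w' := by
  intro s a ha
  rw [Q, Game.qval, add_sub_add_left_eq_sub, ← mul_sub, abs_mul, abs_of_nonneg G.γ_nonneg]
  refine mul_le_mul_of_nonneg_left ?_ G.γ_nonneg
  have h1 := abs_expect_sub_expect_le (G.P s a) (w := v) fun t =>
    abs_clip_sub_le ⟨Game.bellman_nonneg hv t, Game.bellman_le_inv hv t⟩ (h.abs_V_sub_le hv t)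
  have h2 := abs_sub_le (φ s a ⬝ᵥ w') (expect (G.P s a) (fun t => clip G.γ (V G φ w t)))
    (expect (G.P s a) v)
  linarith [h' s a ha]

variable [MeasurableSpace S] [MeasurableSingletonClass S]

/-- Both `Q_w` and `V_w` are within `d` of their counterparts for `v`, so a greedy action violates
the Bellman equation of `v` by at most `2 * d`; the discounted sum of these losses gives the bound.
-/
theorem NearOptimalQ.isOptimalUpTo (hv : G.bellman v = v) {d : ℝ} {w : Fin K → ℝ}
    (h : NearOptimalQ G φ v d w) {π : G.Strategy} (hπ : IsGreedy G φ w π) {ε : ℝ}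
    (hε : 2 * d / (1 - G.γ) ≤ ε) : G.IsOptimalUpTo ε π := by
  refine ⟨v, Game.isEquilibriumValue_of_bellman_eq hv, fun s => ?_⟩
  have hd : 0 ≤ d := (abs_nonneg _).trans (h.abs_V_sub_le hv s)
  have key : ∀ t, |G.qval v t (G.play π t) - v t| ≤ 2 * d := fun t => by
    have h1 := abs_le.1 (h t _ (G.play_mem π t))
    have h2 := abs_le.1 (h.abs_V_sub_le hv t)
    rw [hπ t] at h1
    rw [abs_le]
    constructor <;> linarith [h1.1, h1.2, h2.1, h2.2]
  constructor
  · intro π₁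
    have := Game.value_deviation_le (π := π) (u := v) (e := 2 * d)
      (fun t ht a ha => by linarith [Game.qval_le_of_mem hv ht ha])
      (fun t _ => by linarith [(abs_le.1 (key t)).2]) π₁ s
    linarith
  · intro π₂
    have := Game.le_value_deviation (π := π) (u := v) (e := 2 * d)
      (fun t _ => by linarith [(abs_le.1 (key t)).1])
      (fun t ht a ha => by linarith [Game.le_qval_of_notMem hv ht ha]) π₂ s
    linarith

variable {anchor : Fin K → S × A}

/-- The term `γ * η / (1 - γ)` is the fixed point of `d ↦ γ * (d + η)`. Since every update uses
fresh samples, `hstep` can be applied with the current iterate held fixed. -/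
theorem basicIterate_nearOptimalQ (hv : G.bellman v = v) {T : ℕ} {η q : ℝ} (hη : 0 ≤ η) (hq : 0 ≤ q)
    (hstep : ∀ w, (draws G.P anchor T).toOuterMeasure
      {x | ∀ s, ∀ a ∈ G.act s, |φ s a ⬝ᵥ basicUpdate G φ anchor w x -
        expect (G.P s a) (fun t => clip G.γ (V G φ w t))| ≤ η}ᶜ ≤ ENNReal.ofReal q) (t : ℕ) :
    (basicIterate G φ anchor T t).toOuterMeasure
      {w | NearOptimalQ G φ v (G.γ ^ (t + 1) / (1 - G.γ) + G.γ * η / (1 - G.γ)) w}ᶜ ≤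
        ENNReal.ofReal (t * q) := by
  induction t with
  | zero =>
    rw [basicIterate, toOuterMeasure_pure_compl]
    · exact zero_le
    · intro s a ha
      refine (nearOptimalQ_zero hv s a ha).trans ?_
      rw [zero_add, pow_one, le_add_iff_nonneg_right]
      refine div_nonneg (mul_nonneg G.γ_nonneg hη) G.one_sub_γ_pos.le
  | succ t ih =>
    have e : ((t + 1 : ℕ) : ℝ) * q = t * q + q := by push_cast; ring
    rw [basicIterate, e, ENNReal.ofReal_add (by positivity) hq]
    refine toOuterMeasure_bind_compl_le ih fun w hw => ?_
    refine toOuterMeasure_map_compl_le (hstep w) fun x hx => ?_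
    have h := NearOptimalQ.step hv hw hx
    have e2 : G.γ * (G.γ ^ (t + 1) / (1 - G.γ) + G.γ * η / (1 - G.γ) + η) =
        G.γ ^ (t + 1 + 1) / (1 - G.γ) + G.γ * η / (1 - G.γ) := by
      have := G.one_sub_γ_pos
      field_simp
      ring
    rwa [e2] at h

theorem average_mem_Icc {n : ℕ} {f : Fin n → ℝ} {b : ℝ} (hb : 0 ≤ b)
    (hf : ∀ i, f i ∈ Set.Icc 0 b) : (1 / (n : ℝ)) * ∑ i, f i ∈ Set.Icc 0 b := by
  refine ⟨mul_nonneg (by positivity) (Finset.sum_nonneg fun i _ => (hf i).1), ?_⟩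
  have h : ∑ i, f i ≤ n * b := by
    simpa using Finset.sum_le_sum fun i (_ : i ∈ Finset.univ) => (hf i).2
  rcases n.eq_zero_or_pos with rfl | hn
  · simpa using hb
  · have : (0 : ℝ) < n := by exact_mod_cast hn
    calc (1 / (n : ℝ)) * ∑ i, f i ≤ 1 / n * (n * b) := by gcongr
      _ = b := by field_simp

/-- One accurate update of the basic algorithm, by the Hoeffding inequality. -/
theorem basicUpdate_accurate {L : ℝ} (hA : AnchorCondition G φ anchor L) (hP : Embeds G.P φ)
    (hL : 0 ≤ L) {T : ℕ} (hT : 0 < T) {κ : ℝ} (hκ : 0 ≤ κ) (w : Fin K → ℝ) :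
    (draws G.P anchor T).toOuterMeasure
      {x | ∀ s, ∀ a ∈ G.act s, |φ s a ⬝ᵥ basicUpdate G φ anchor w x -
        expect (G.P s a) (fun t => clip G.γ (V G φ w t))| ≤
          L * (1 / (1 - G.γ) * √(κ / T))}ᶜ ≤ ENNReal.ofReal (K * (2 * Real.exp (-(2 * κ)))) := by
  have hb : 0 < 1 / (1 - G.γ) := one_div_pos.2 G.one_sub_γ_pos
  have hT' : (0 : ℝ) < T := by exact_mod_cast hT
  have ht : 0 ≤ 1 / (1 - G.γ) * √(κ / T) := by positivity
  refine le_trans (measure_mono ?_) (draws_deviation_le G.P anchor hT (κ := 2 * κ)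
    (t := 1 / (1 - G.γ) * √(κ / T)) hb ht (fun s => clip_mem_Icc G (V G φ w s)) (le_of_eq ?_))
  · intro x hx hx'
    exact hx fun s a ha => hA.abs_sub_le hP hL ht hx' ha
  · rw [mul_pow, Real.sq_sqrt (by positivity)]
    field_simp

theorem basicAlgorithm_nearOptimalQ {L ε δ : ℝ} (hv : G.bellman v = v) (hL : 0 < L)
    (hA : AnchorCondition G φ anchor L) (hP : Embeds G.P φ) (hK : 0 < K) (hε : 0 < ε)
    (hε1 : ε < 1) (hδ : 0 < δ) (hδ1 : δ < 1) :
    (basicAlgorithm 10 4 G φ anchor L ε δ).toOuterMeasure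
      {w | NearOptimalQ G φ v ((1 - G.γ) * ε) w}ᶜ ≤ ENNReal.ofReal δ := by
  have hγ := G.one_sub_γ_pos
  have hγ0 := G.γ_nonneg
  set x : ℝ := (1 - G.γ) * ε with hx
  have hx0 : 0 < x := mul_pos hγ hε
  have hxγ : x ≤ 1 - G.γ := mul_le_of_le_one_right hγ.le hε1.le
  have hx1 : x < 1 := by
    calc x < (1 - G.γ) * 1 := mul_lt_mul_of_pos_left hε1 hγ
      _ ≤ 1 := by linarith
  have hlog : 0 < Real.log (1 / x) := Real.log_pos ((one_lt_div hx0).2 hx1)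
  set R := basicR 10 G.γ ε with hR
  have hRle : 10 * (1 / (1 - G.γ) * Real.log (1 / x)) ≤ R := Nat.le_ceil _
  have hRpos : 0 < R := Nat.ceil_pos.2 (by positivity)
  set T := basicT 4 G.γ ε δ L K R with hT
  change (basicIterate G φ anchor T R).toOuterMeasure _ ≤ _
  -- The union bound below needs `2 * δ ≤ K * R`, which can fail only for `K * R = 1`. In that case
  -- the output is accurate with certainty: the extrapolation is constant and clipped, so its error
  -- is at most `1 / (1 - γ)`, while `R = 1` forces `γ` to be small.
  by_cases hN : K * R = 1
  · obtain ⟨rfl, hR1⟩ := mul_eq_one.1 hN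
    have h := basicIterate_nearOptimalQ (φ := φ) (anchor := anchor) (T := T) (q := 0)
      (η := 1 / (1 - G.γ)) hv (by positivity) le_rfl (fun w => by
        refine (le_of_eq ?_).trans zero_le
        convert measure_empty (μ := (draws G.P anchor T).toOuterMeasure) using 2
        rw [Set.compl_empty_iff, Set.eq_univ_iff_forall]
        intro y s a _
        have hb : 0 < 1 / (1 - G.γ) := one_div_pos.2 hγ
        rw [basicUpdate, extrapolation_one hP hA.2.1]
        have h1 := average_mem_Icc hb.le fun i => clip_mem_Icc G (V G φ w (y 0 i))
        have h2 := le_expect (G.P s a) fun t => (clip_mem_Icc G (V G φ w t)).1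
        have h3 := expect_le (G.P s a) fun t => (clip_mem_Icc G (V G φ w t)).2
        rw [abs_le]
        constructor <;> linarith [h1.1, h1.2]) R
    rw [mul_zero, ENNReal.ofReal_zero] at h
    refine (le_trans (measure_mono ?_) h).trans zero_le
    refine Set.compl_subset_compl.2 fun w hw s a ha => (hw s a ha).trans ?_
    rw [hR1] at hRle ⊢
    -- This is where the constant `10` in the number of iterations is needed; elsewhere `3` would
    -- do.
    have h1 : Real.log (1 / x) ≤ 1 / 10 := by
      have : 1 ≤ 1 / (1 - G.γ) := (one_le_div hγ).2 (by linarith)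
      push_cast at hRle
      nlinarith
    have h2 : 9 / 10 ≤ x := by
      have h3 := Real.log_le_sub_one_of_pos hx0
      rw [one_div, Real.log_inv] at h1
      linarith
    have h4 : G.γ ≤ 1 / 10 := by linarith
    have h5 : G.γ ^ (1 + 1) / (1 - G.γ) + G.γ * (1 / (1 - G.γ)) / (1 - G.γ) ≤ 9 / 10 := by
      rw [div_add_div _ _ hγ.ne' hγ.ne', div_le_iff₀ (by positivity), mul_one_div]
      rw [← mul_div_assoc, mul_div_cancel_left₀ _ hγ.ne']
      nlinarith
    exact h5.trans h2
  · have hN2 : 2 ≤ K * R := by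
      have := Nat.mul_pos hK hRpos
      omega
    have hN2' : (2 : ℝ) ≤ K * R := by exact_mod_cast hN2
    set Λ := Real.log (K * R / δ) with hΛ
    have hΛ0 : 0 < Λ := Real.log_pos ((one_lt_div hδ).2 (by linarith))
    have hTle : 4 * (L ^ 2 * Λ / (ε ^ 2 * (1 - G.γ) ^ 6)) ≤ T := Nat.le_ceil _
    have hTpos : 0 < T := Nat.ceil_pos.2 (by positivity)
    have hT' : (0 : ℝ) < T := by exact_mod_cast hTpos
    have h := basicIterate_nearOptimalQ (φ := φ) (anchor := anchor) hv (by positivity)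
      (by positivity) (basicUpdate_accurate hA hP hL.le hTpos hΛ0.le) R
    set η := L * (1 / (1 - G.γ) * √(Λ / T)) with hη
    have hsq : √(Λ / T) ≤ ε * (1 - G.γ) ^ 3 / (2 * L) := by
      refine Real.sqrt_le_iff.2 ⟨by positivity, ?_⟩
      rw [div_le_iff₀ hT', div_pow, div_mul_eq_mul_div, le_div_iff₀ (by positivity)]
      rw [← mul_div_assoc, div_le_iff₀ (by positivity)] at hTle
      nlinarith
    have hη2 : η ≤ ε * (1 - G.γ) ^ 2 / 2 := by
      calc η ≤ L * (1 / (1 - G.γ) * (ε * (1 - G.γ) ^ 3 / (2 * L))) := by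
            rw [hη]
            gcongr
        _ = _ := by field_simp
    have hpow : G.γ ^ R ≤ x ^ 3 := by
      refine (pow_le_exp_neg hγ0 R).trans ?_
      rw [← exp_neg_nat_mul_log 3 hx0]
      refine Real.exp_le_exp.2 (neg_le_neg ?_)
      have h1 := mul_le_mul_of_nonneg_left hRle hγ.le
      have h2 : (1 - G.γ) * (10 * (1 / (1 - G.γ) * Real.log (1 / x))) = 10 * Real.log (1 / x) := by
        field_simp
      rw [h2] at h1
      push_cast
      linarith
    refine (le_trans (measure_mono ?_) h).trans (ENNReal.ofReal_le_ofReal ?_)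
    · refine Set.compl_subset_compl.2 fun w hw s a ha => (hw s a ha).trans ?_
      -- The error budget `x` is split: a quarter for the initial error, half for the sampling
      -- noise.
      have h1 : G.γ ^ (R + 1) / (1 - G.γ) ≤ x * (1 / 4) := by
        rw [div_le_iff₀ hγ, pow_succ]
        have h3 : x ^ 3 * G.γ ≤ x * 1 * (1 - G.γ) * (1 / 4) := by
          have : x * x ≤ (1 - G.γ) * (1 - G.γ) := mul_self_le_mul_self hx0.le hxγ
          have h5 : (1 - G.γ) * G.γ ≤ 1 / 4 := by nlinarith [sq_nonneg (G.γ - 1 / 2)]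
          have h6 : x * x * G.γ ≤ (1 - G.γ) * (1 / 4) := by nlinarith
          calc x ^ 3 * G.γ = x * (x * x * G.γ) := by ring
            _ ≤ x * ((1 - G.γ) * (1 / 4)) := mul_le_mul_of_nonneg_left h6 hx0.le
            _ = _ := by ring
        linarith [mul_le_mul_of_nonneg_right hpow hγ0]
      have h2 : G.γ * η / (1 - G.γ) ≤ x * (1 / 2) := by
        rw [div_le_iff₀ hγ]
        have hη0 : 0 ≤ η := by positivity
        have : G.γ * η ≤ η := mul_le_of_le_one_left hη0 G.γ_lt_one.le
        rw [hx]
        nlinarith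
      linarith
    · have e1 : Real.exp (-(2 * Λ)) = (δ / (K * R)) ^ 2 := by
        have h3 := exp_neg_nat_mul_log 2 (x := δ / (K * R)) (by positivity)
        rwa [one_div_div, Nat.cast_ofNat] at h3
      -- The exponent `2 * Λ` squares `δ / (K * R)`; the spare factor `2 * δ / (K * R)` pays for the
      -- two tails of the Hoeffding bound.
      have e2 : (R : ℝ) * (K * (2 * (δ / (K * R)) ^ 2)) = δ * (2 * δ / (K * R)) := by
        have : (0 : ℝ) < R := by exact_mod_cast hRpos
        have : (0 : ℝ) < K := by exact_mod_cast hK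
        field_simp
      rw [e1, e2]
      refine mul_le_of_le_one_right hδ.le ((div_le_one (by positivity)).2 ?_)
      linarith

end Basic

/-! ### One-sided Q-learning with variance reduction -/

theorem V_le_Vmax (G : Game S A) (φ : S → A → Fin K → ℝ) {θ : Params K} {w : Fin K → ℝ}
    (hw : w ∈ θ.1) (s : S) : V G φ w s ≤ Vmax G φ θ s :=
  Finset.le_sup' (fun w => V G φ w s) hw

theorem Vmax_mono (G : Game S A) (φ : S → A → Fin K → ℝ) {θ θ' : Params K} (h : θ.1 ⊆ θ'.1)
    (s : S) : Vmax G φ θ s ≤ Vmax G φ θ' s :=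
  Finset.sup'_mono _ h θ.2

theorem V_zero_nonneg (G : Game S A) (φ : S → A → Fin K → ℝ) (s : S) : 0 ≤ V G φ 0 s := by
  obtain ⟨a, -, h⟩ := exists_greedy_action G φ 0 s
  rw [← h, Q, dotProduct_zero, mul_zero, add_zero]
  exact G.r_nonneg s a

section OneSided

variable [Fintype S] {G : Game S A} {φ : S → A → Fin K → ℝ} {anchor : Fin K → S × A} {v : S → ℝ}

/-- The parameters in `θ` underestimate the expectations of `V_θ`. -/
def IsLowerParams (G : Game S A) (φ : S → A → Fin K → ℝ) (θ : Params K) : Prop :=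
  0 ∈ θ.1 ∧ ∀ w ∈ θ.1, ∀ s, ∀ a ∈ G.act s, φ s a ⬝ᵥ w ≤ expect (G.P s a) (Vmax G φ θ)

namespace IsLowerParams

variable {θ : Params K}

theorem Q_le (h : IsLowerParams G φ θ) {w : Fin K → ℝ} (hw : w ∈ θ.1) {s : S} {a : A}
    (ha : a ∈ G.act s) : Q G φ w s a ≤ G.qval (Vmax G φ θ) s a :=
  add_le_add_right (mul_le_mul_of_nonneg_left (h.2 w hw s a ha) G.γ_nonneg) _

theorem Vmax_nonneg (h : IsLowerParams G φ θ) (s : S) : 0 ≤ Vmax G φ θ s :=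
  (V_zero_nonneg G φ s).trans (V_le_Vmax G φ h.1 s)

/-- Each `V_w` is the optimum of a `Q_w` that lies below the action values of `Vmax`, and `opt` is
monotone. -/
theorem Vmax_le_bellman (h : IsLowerParams G φ θ) (s : S) :
    Vmax G φ θ s ≤ G.bellman (Vmax G φ θ) s :=
  Finset.sup'_le _ _ fun _ hw => G.opt_mono s fun _ ha => h.Q_le hw ha

theorem Vmax_le (h : IsLowerParams G φ θ) (hv : G.bellman v = v) (s : S) :
    Vmax G φ θ s ≤ v s :=
  Game.le_of_le_bellman hv h.Vmax_le_bellman s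

theorem le_qval_of_isMaxLinearAction (h : IsLowerParams G φ θ) {s : S} {a : A}
    (ha : IsMaxLinearAction G φ θ s a) : Vmax G φ θ s ≤ G.qval (Vmax G φ θ) s a := by
  obtain ⟨ha, w, hw, h1, h2⟩ := ha
  rw [← h1, ← h2]
  exact h.Q_le hw ha

theorem le_qval_of_notMem (h : IsLowerParams G φ θ) {s : S} (hs : s ∉ G.maxStates) {a : A}
    (ha : a ∈ G.act s) : Vmax G φ θ s ≤ G.qval (Vmax G φ θ) s a :=
  (h.Vmax_le_bellman s).trans (G.opt_le hs _ ha)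

theorem zero (G : Game S A) (φ : S → A → Fin K → ℝ) :
    IsLowerParams G φ ⟨{0}, Finset.singleton_nonempty _⟩ := by
  refine ⟨Finset.mem_singleton_self _, fun w hw s a _ => ?_⟩
  rw [Finset.mem_singleton.1 hw, dotProduct_zero]
  exact le_expect _ fun t => (V_zero_nonneg G φ t).trans
    (V_le_Vmax G φ (Finset.mem_singleton_self _) t)

end IsLowerParams

theorem abs_vrUpdate_target_sub_le {m₁ : ℕ} {t₀ t₁ : ℝ} {θ₀ θ : Params K} {M₀ : Fin K → ℝ}
    {x : Fin K → Fin m₁ → S}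
    (hM₀ : ∀ k, |M₀ k - expect (G.P (anchor k).1 (anchor k).2) (Vmax G φ θ₀)| ≤ t₀)
    (hx : ∀ k, |(1 / (m₁ : ℝ)) * ∑ l, (Vmax G φ θ (x k l) - Vmax G φ θ₀ (x k l)) -
      expect (G.P (anchor k).1 (anchor k).2) (fun s => Vmax G φ θ s - Vmax G φ θ₀ s)| ≤ t₁)
    (k : Fin K) :
    |(1 / (m₁ : ℝ)) * ∑ l, (Vmax G φ θ (x k l) - Vmax G φ θ₀ (x k l)) + M₀ k -
      expect (G.P (anchor k).1 (anchor k).2) (Vmax G φ θ)| ≤ t₀ + t₁ := by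
  have h0 := abs_le.1 (hM₀ k)
  have h1 := abs_le.1 (hx k)
  rw [expect_sub] at h1
  rw [abs_le]
  constructor <;> linarith [h0.1, h0.2, h1.1, h1.2]

/-- An accurate update keeps the parameters underestimates and contracts the gap to `v`. -/
theorem vrUpdate_spec {L t e D : ℝ} (hv : G.bellman v = v) (hL : 0 ≤ L) (ht : 0 ≤ t)
    (hA : AnchorCondition G φ anchor L) (hP : Embeds G.P φ) (hφ : ∀ s a k, 0 ≤ φ s a k)
    (he : L * t ≤ e) {m₁ : ℕ} {θ₀ θ : Params K} {M₀ : Fin K → ℝ} {x : Fin K → Fin m₁ → S}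
    (hx : ∀ k, |(1 / (m₁ : ℝ)) * ∑ l, (Vmax G φ θ (x k l) - Vmax G φ θ₀ (x k l)) + M₀ k -
      expect (G.P (anchor k).1 (anchor k).2) (Vmax G φ θ)| ≤ t)
    (hθ : IsLowerParams G φ θ) (hD : ∀ s, v s - Vmax G φ θ s ≤ D) :
    θ.1 ⊆ (vrUpdate G φ anchor e θ₀ M₀ θ x).1 ∧
      IsLowerParams G φ (vrUpdate G φ anchor e θ₀ M₀ θ x) ∧
      ∀ s, v s - Vmax G φ (vrUpdate G φ anchor e θ₀ M₀ θ x) s ≤ G.γ * D + 2 * e := by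
  set θ' := vrUpdate G φ anchor e θ₀ M₀ θ x
  set M : Fin K → ℝ := fun k => (1 / (m₁ : ℝ)) * ∑ l, (Vmax G φ θ (x k l) - Vmax G φ θ₀ (x k l)) +
    M₀ k with hM
  set w : Fin K → ℝ := fun k => ((anchorMatrix φ anchor)⁻¹ *ᵥ M) k - e with hw
  have hθ' : θ'.1 = insert w θ.1 := rfl
  have hsub : θ.1 ⊆ θ'.1 := hθ' ▸ Finset.subset_insert _ _
  have hwmem : w ∈ θ'.1 := hθ' ▸ Finset.mem_insert_self _ _
  have he0 : 0 ≤ e := (mul_nonneg hL ht).trans he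
  have hφw : ∀ s a, φ s a ⬝ᵥ w = φ s a ⬝ᵥ ((anchorMatrix φ anchor)⁻¹ *ᵥ M) -
      (∑ k, φ s a k) * e := fun s a => by
    simp only [hw, dotProduct, mul_sub, Finset.sum_sub_distrib, Finset.sum_mul]
  -- For nonnegative features, subtracting `e` from all coordinates lowers the prediction by `(∑ k,
  -- φ s a k) * e`, at least the extrapolation error with the same factor. Hence the new vector
  -- underestimates, by at most `2 * e` because the factor is at most `1`.
  have hest : ∀ s, ∀ a ∈ G.act s, φ s a ⬝ᵥ w ≤ expect (G.P s a) (Vmax G φ θ) ∧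
      expect (G.P s a) (Vmax G φ θ) - 2 * e ≤ φ s a ⬝ᵥ w := fun s a ha => by
    have h1 := abs_le.1 (abs_extrapolation_sub_expect_le hP hA.2.1 hA.2.2 ht hx s a)
    have h2 : ∑ k, |φ s a k| = ∑ k, φ s a k :=
      Finset.sum_congr rfl fun k _ => abs_of_nonneg (hφ s a k)
    have h3 := hA.1 s a ha
    rw [h2] at h1 h3
    have h0 : 0 ≤ ∑ k, φ s a k := Finset.sum_nonneg fun k _ => hφ s a k
    have h4 := mul_le_mul_of_nonneg_left he h0
    have h5 := mul_le_of_le_one_left he0 h3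
    rw [hφw]
    constructor <;> linarith [h1.1, h1.2]
  have hmono : ∀ s, Vmax G φ θ s ≤ Vmax G φ θ' s := Vmax_mono G φ hsub
  refine ⟨hsub, ⟨hsub hθ.1, fun w' hw' s a ha => ?_⟩, fun s => ?_⟩
  -- Enlarging the collection raises `Vmax`, so old members stay underestimates.
  · refine le_trans ?_ (expect_mono _ hmono)
    rcases Finset.mem_insert.1 (hθ' ▸ hw') with rfl | hw'
    · exact (hest s a ha).1
    · exact hθ.2 w' hw' s a ha
  · have h1 := V_le_Vmax G φ hwmem s
    have h2 : G.opt s (G.qval v s) ≤ G.opt s (Q G φ w s) + (G.γ * D + 2 * e) := by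
      refine G.opt_le_opt_add s fun a ha => ?_
      have h3 := (hest s a ha).2
      have h4 := expect_le_expect_add (G.P s a) (u := v) (w := Vmax G φ θ) (d := D)
        fun t => by linarith [hD t]
      have h5 : G.γ * expect (G.P s a) v ≤ G.γ * (φ s a ⬝ᵥ w + 2 * e + D) :=
        mul_le_mul_of_nonneg_left (by linarith) G.γ_nonneg
      have h6 : G.γ * (2 * e) ≤ 2 * e := mul_le_of_le_one_left (by linarith) G.γ_lt_one.le
      rw [Game.qval, Q]
      linarith
    have h3 : G.opt s (G.qval v s) = v s := congrFun hv s
    have h4 : G.opt s (Q G φ w s) = V G φ w s := rfl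
    linarith

variable [MeasurableSpace S] [MeasurableSingletonClass S]

/-- This is the variance reduction: the range in the Hoeffding condition `hκ` is the initial gap `u`
instead of `1 / (1 - γ)`. The full-range error `t₀` of the reference enters only through `e`, and `2
* e / (1 - γ)` is the fixed point of `D ↦ γ * D + 2 * e`. -/
theorem vrInnerLoop_spec {L t₀ t₁ e u κ : ℝ} (hv : G.bellman v = v) (hL : 0 ≤ L) (ht₀ : 0 ≤ t₀)
    (ht₁ : 0 ≤ t₁) (hA : AnchorCondition G φ anchor L) (hP : Embeds G.P φ)
    (hφ : ∀ s a k, 0 ≤ φ s a k) (he : L * (t₀ + t₁) ≤ e) {m₁ : ℕ} (hm₁ : 0 < m₁) (hu : 0 < u)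
    (hκ : u ^ 2 * κ ≤ 2 * m₁ * t₁ ^ 2) {θ₀ : Params K} {M₀ : Fin K → ℝ}
    (hM₀ : ∀ k, |M₀ k - expect (G.P (anchor k).1 (anchor k).2) (Vmax G φ θ₀)| ≤ t₀)
    (hθ₀ : IsLowerParams G φ θ₀) (hu₀ : ∀ s, v s - Vmax G φ θ₀ s ≤ u) (j : ℕ) :
    (vrInnerLoop G φ anchor m₁ e θ₀ M₀ j).toOuterMeasure
      {θ | θ₀.1 ⊆ θ.1 ∧ IsLowerParams G φ θ ∧
        ∀ s, v s - Vmax G φ θ s ≤ G.γ ^ j * u + 2 * e / (1 - G.γ)}ᶜ ≤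
      ENNReal.ofReal (j * (K * (2 * Real.exp (-κ)))) := by
  have hγ := G.one_sub_γ_pos
  have he0 : 0 ≤ e := (mul_nonneg hL (add_nonneg ht₀ ht₁)).trans he
  induction j with
  | zero =>
    rw [vrInnerLoop, toOuterMeasure_pure_compl]
    · exact zero_le
    · refine ⟨Finset.Subset.refl _, hθ₀, fun s => (hu₀ s).trans ?_⟩
      rw [pow_zero, one_mul, le_add_iff_nonneg_right]
      positivity
  | succ j ih =>
    have hq : ((j + 1 : ℕ) : ℝ) * (K * (2 * Real.exp (-κ))) =
        j * (K * (2 * Real.exp (-κ))) + K * (2 * Real.exp (-κ)) := by push_cast; ring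
    rw [vrInnerLoop, hq, ENNReal.ofReal_add (by positivity) (by positivity)]
    refine toOuterMeasure_bind_compl_le ih fun θ hθ => ?_
    obtain ⟨hsub, hlow, hgap⟩ := hθ
    refine toOuterMeasure_map_compl_le (draws_deviation_le G.P anchor hm₁
      (f := fun s => Vmax G φ θ s - Vmax G φ θ₀ s) hu ht₁ (fun s => ?_) hκ) fun x hx => ?_
    -- Between the reference and `v`, the function `Vmax` can rise by at most `u`.
    · have h1 := Vmax_mono G φ hsub s
      have h2 := hlow.Vmax_le hv s
      have h3 := hu₀ s
      constructor <;> linarith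
    · obtain ⟨h1, h2, h3⟩ := vrUpdate_spec hv hL (add_nonneg ht₀ ht₁) hA hP hφ he
        (abs_vrUpdate_target_sub_le hM₀ hx) hlow hgap
      refine ⟨hsub.trans h1, h2, fun s => (h3 s).trans (le_of_eq ?_)⟩
      field_simp
      ring

/-- `u i` is the gap promised at the start of outer iteration `i`. Each iteration makes one
reference draw and `R` inner draws, whence the factor `R + 1`. -/
theorem vrOuterLoop_spec {L t₀ κ : ℝ} {t₁ e u : ℕ → ℝ} (hv : G.bellman v = v) (hL : 0 ≤ L)
    (ht₀ : 0 ≤ t₀) (ht₁ : ∀ i, 0 ≤ t₁ i) (hA : AnchorCondition G φ anchor L)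
    (hP : Embeds G.P φ) (hφ : ∀ s a k, 0 ≤ φ s a k) (he : ∀ i, L * (t₀ + t₁ i) ≤ e i)
    {m m₁ R : ℕ} (hm : 0 < m) (hm₁ : 0 < m₁) (hu : ∀ i, 0 < u i)
    (hκ₀ : (1 / (1 - G.γ)) ^ 2 * κ ≤ 2 * m * t₀ ^ 2)
    (hκ : ∀ i, u i ^ 2 * κ ≤ 2 * m₁ * t₁ i ^ 2) (hu₀ : 1 / (1 - G.γ) ≤ u 0) {n : ℕ}
    (hstep : ∀ i < n, G.γ ^ R * u i + 2 * e i / (1 - G.γ) ≤ u (i + 1)) {i : ℕ} (hi : i ≤ n) :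
    (vrOuterLoop G φ anchor m m₁ R e i).toOuterMeasure
      {θ | IsLowerParams G φ θ ∧ ∀ s, v s - Vmax G φ θ s ≤ u i}ᶜ ≤
      ENNReal.ofReal (i * ((R + 1) * (K * (2 * Real.exp (-κ))))) := by
  have hγ := one_div_pos.2 G.one_sub_γ_pos
  induction i with
  | zero =>
    rw [vrOuterLoop, toOuterMeasure_pure_compl]
    · exact zero_le
    · have h := IsLowerParams.zero G φ
      refine ⟨h, fun s => le_trans ?_ hu₀⟩
      linarith [Game.bellman_le_inv hv s, h.Vmax_nonneg s]
  | succ i ih =>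
    have hq : ((i + 1 : ℕ) : ℝ) * ((R + 1) * (K * (2 * Real.exp (-κ)))) =
        i * ((R + 1) * (K * (2 * Real.exp (-κ)))) +
          (K * (2 * Real.exp (-κ)) + R * (K * (2 * Real.exp (-κ)))) := by push_cast; ring
    rw [vrOuterLoop, hq, ENNReal.ofReal_add (by positivity) (by positivity),
      ENNReal.ofReal_add (by positivity) (by positivity)]
    refine toOuterMeasure_bind_compl_le (ih (by omega)) fun θ₀ hθ₀ => ?_
    obtain ⟨hlow, hgap⟩ := hθ₀
    refine toOuterMeasure_bind_compl_le (draws_deviation_le G.P anchor hm (f := Vmax G φ θ₀) hγ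
      ht₀ (fun s => ⟨hlow.Vmax_nonneg s, (hlow.Vmax_le hv s).trans (Game.bellman_le_inv hv s)⟩)
      hκ₀) fun x hx => ?_
    refine le_trans (measure_mono ?_) (vrInnerLoop_spec hv hL ht₀ (ht₁ i) hA hP hφ (he i) hm₁
      (hu i) (hκ i) (M₀ := vrReference G φ θ₀ x) hx hlow hgap R)
    refine Set.compl_subset_compl.2 fun θ hθ => ⟨hθ.2.1, fun s => (hθ.2.2 s).trans ?_⟩
    exact hstep i (by omega)

/-! ### The choice of the constants -/

/-- Suitable constants of the variance-reduced algorithm. -/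
def vrConst : VRConst where
  -- `outer` brings `2⁻¹ ^ R'` within a factor `2` of `ε * (1 - γ)`; `inner` gives `γ ^ R ≤ exp (-3)
  -- ≤ 1 / 8`; `1024 = 32 ^ 2` scales both square roots by `1 / 32`; the shifts `2` yield a
  -- Hoeffding exponent of at least `4 * Λ`.
  outer := 1 / Real.log 2
  inner := 3
  m := 1024
  m₁ := 1024
  shift₁ := 2
  shift₂ := 2
  outer_pos := one_div_pos.2 (Real.log_pos one_lt_two)
  inner_pos := by norm_num
  m_pos := by norm_num
  m₁_pos := by norm_num
  shift₁_pos := by norm_num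
  shift₂_pos := by norm_num

theorem inv_two_pow_eq_exp (n : ℕ) : (2 : ℝ)⁻¹ ^ n = Real.exp (-(n * Real.log 2)) := by
  rw [← exp_neg_nat_mul_log n (by norm_num : (0 : ℝ) < 2⁻¹), one_div, inv_inv]

theorem inv_two_pow_vrOuter_le {γ ε : ℝ} (hx : 0 < ε * (1 - γ)) :
    (2 : ℝ)⁻¹ ^ vrOuter vrConst γ ε ≤ ε * (1 - γ) := by
  have h2 : 0 < Real.log 2 := Real.log_pos one_lt_two
  have h : 1 / Real.log 2 * Real.log (1 / (ε * (1 - γ))) ≤ vrOuter vrConst γ ε := Nat.le_ceil _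
  rw [one_div_mul_eq_div, div_le_iff₀ h2, one_div, Real.log_inv] at h
  rw [inv_two_pow_eq_exp]
  conv_rhs => rw [← Real.exp_log hx]
  exact Real.exp_le_exp.2 (by linarith)

theorem le_inv_two_pow_vrOuter {γ ε : ℝ} (hx : 0 < ε * (1 - γ)) (hx1 : ε * (1 - γ) ≤ 1) :
    ε * (1 - γ) / 2 ≤ (2 : ℝ)⁻¹ ^ vrOuter vrConst γ ε := by
  have h2 : 0 < Real.log 2 := Real.log_pos one_lt_two
  have h : (vrOuter vrConst γ ε : ℝ) < 1 / Real.log 2 * Real.log (1 / (ε * (1 - γ))) + 1 :=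
    Nat.ceil_lt_add_one (mul_nonneg vrConst.outer_pos.le (Real.log_nonneg ((one_le_div hx).2 hx1)))
  rw [one_div_mul_eq_div, ← sub_lt_iff_lt_add, lt_div_iff₀ h2, one_div, Real.log_inv] at h
  rw [inv_two_pow_eq_exp]
  have h3 : ε * (1 - γ) / 2 = Real.exp (Real.log (ε * (1 - γ)) - Real.log 2) := by
    rw [Real.exp_sub, Real.exp_log hx, Real.exp_log two_pos]
  rw [h3]
  exact Real.exp_le_exp.2 (by linarith)

theorem pow_vrInner_le {γ ε : ℝ} (h0 : 0 ≤ γ) (h1 : γ < 1) (hR : 0 < vrOuter vrConst γ ε) :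
    γ ^ vrInner vrConst γ ε ≤ 1 / 8 := by
  have hγ : 0 < 1 - γ := sub_pos.2 h1
  have hR' : (1 : ℝ) ≤ vrOuter vrConst γ ε := by exact_mod_cast hR
  have h : 3 * (vrOuter vrConst γ ε / (1 - γ)) ≤ vrInner vrConst γ ε := Nat.le_ceil _
  have h3 : 3 ≤ (1 - γ) * vrInner vrConst γ ε := by
    have := mul_le_mul_of_nonneg_left h hγ.le
    have e : (1 - γ) * (3 * (vrOuter vrConst γ ε / (1 - γ))) = 3 * vrOuter vrConst γ ε := by
      field_simp
    linarith
  refine (pow_le_exp_neg h0 _).trans ((Real.exp_le_exp.2 (neg_le_neg h3)).trans ?_)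
  have h2 : (2 : ℝ) ≤ Real.exp 1 := by linarith [Real.add_one_le_exp 1]
  have h4 : Real.exp 3 = Real.exp 1 ^ 3 := by rw [← Real.exp_nat_mul]; norm_num
  rw [Real.exp_neg, h4, one_div]
  refine inv_anti₀ (by norm_num) ?_
  calc (8 : ℝ) = 2 ^ 3 := by norm_num
    _ ≤ _ := pow_le_pow_left₀ (by norm_num) h2 3

/-- The one-sided algorithm finds parameters that underestimate the equilibrium value by at most
`ε`. -/
theorem oneSidedAlgorithm_spec {L ε δ : ℝ} (hv : G.bellman v = v) (hL : 0 < L)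
    (hA : AnchorCondition G φ anchor L) (hP : Embeds G.P φ) (hφ : ∀ s a k, 0 ≤ φ s a k)
    (hK : 0 < K) (hε : 0 < ε) (hε1 : ε < 1) (hδ : 0 < δ) (hδ1 : δ ≤ 1 / 2) :
    (oneSidedAlgorithm vrConst G φ anchor L ε δ).toOuterMeasure
      {θ | IsLowerParams G φ θ ∧ ∀ s, v s - Vmax G φ θ s ≤ ε}ᶜ ≤ ENNReal.ofReal δ := by
  have hγ := G.one_sub_γ_pos
  have hγ0 := G.γ_nonneg
  have hx : 0 < ε * (1 - G.γ) := mul_pos hε hγ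
  have hx1 : ε * (1 - G.γ) < 1 := by nlinarith
  have hlog : 0 < Real.log (1 / (ε * (1 - G.γ))) := Real.log_pos ((one_lt_div hx).2 hx1)
  have hpow := inv_two_pow_vrOuter_le hx
  have hpow' := le_inv_two_pow_vrOuter hx hx1.le
  have hR' : 0 < vrOuter vrConst G.γ ε := Nat.ceil_pos.2 (mul_pos vrConst.outer_pos hlog)
  have hγR := pow_vrInner_le hγ0 G.γ_lt_one hR'
  have hR'1 : (1 : ℝ) ≤ vrOuter vrConst G.γ ε := by exact_mod_cast hR'
  have hR : 0 < vrInner vrConst G.γ ε :=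
    Nat.ceil_pos.2 (mul_pos vrConst.inner_pos (by positivity))
  have hR1 : (1 : ℝ) ≤ vrInner vrConst G.γ ε := by exact_mod_cast hR
  have hK1 : (1 : ℝ) ≤ K := by exact_mod_cast hK
  have hN1 : (1 : ℝ) ≤ (vrOuter vrConst G.γ ε : ℝ) * vrInner vrConst G.γ ε * K :=
    one_le_mul_of_one_le_of_one_le (one_le_mul_of_one_le_of_one_le hR'1 hR1) hK1
  have hΛ : 0 < vrLog vrConst G.γ ε δ K := Real.log_pos ((one_lt_div hδ).2 (by linarith))
  have hm : 1024 * (L ^ 2 * vrLog vrConst G.γ ε δ K / (ε ^ 2 * (1 - G.γ) ^ 4)) ≤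
      vrM vrConst G.γ ε δ L K := Nat.le_ceil _
  have hm₁ : 1024 * (L ^ 2 * vrLog vrConst G.γ ε δ K / (1 - G.γ) ^ 2) ≤
      vrM₁ vrConst G.γ ε δ L K := Nat.le_ceil _
  have hmpos : 0 < vrM vrConst G.γ ε δ L K :=
    Nat.ceil_pos.2 (mul_pos vrConst.m_pos (by positivity))
  have hm₁pos : 0 < vrM₁ vrConst G.γ ε δ L K :=
    Nat.ceil_pos.2 (mul_pos vrConst.m₁_pos (by positivity))
  have hexp : Real.exp (-(4 * vrLog vrConst G.γ ε δ K)) =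
      (δ / (vrOuter vrConst G.γ ε * vrInner vrConst G.γ ε * K)) ^ 4 := by
    have h3 := exp_neg_nat_mul_log 4
      (x := δ / (vrOuter vrConst G.γ ε * vrInner vrConst G.γ ε * K)) (by positivity)
    rwa [one_div_div, Nat.cast_ofNat] at h3
  have hshift : ∀ i, vrShift vrConst G.γ ε δ L K i =
      2 * (L / (1 - G.γ) * √(vrLog vrConst G.γ ε δ K / vrM vrConst G.γ ε δ L K)) +
      2 * (L * (2 : ℝ)⁻¹ ^ i / (1 - G.γ) *
        √(vrLog vrConst G.γ ε δ K / vrM₁ vrConst G.γ ε δ L K)) := fun i => rfl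
  rw [oneSidedAlgorithm]
  set e := vrShift vrConst G.γ ε δ L K
  set Λ := vrLog vrConst G.γ ε δ K
  set m := vrM vrConst G.γ ε δ L K
  set m₁ := vrM₁ vrConst G.γ ε δ L K
  set R' := vrOuter vrConst G.γ ε
  set R := vrInner vrConst G.γ ε
  have hm' : (0 : ℝ) < m := by exact_mod_cast hmpos
  have hm₁' : (0 : ℝ) < m₁ := by exact_mod_cast hm₁pos
  have hsq : √(Λ / m) ≤ ε * (1 - G.γ) ^ 2 / (32 * L) := by
    refine Real.sqrt_le_iff.2 ⟨by positivity, ?_⟩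
    rw [div_le_iff₀ hm', div_pow, div_mul_eq_mul_div, le_div_iff₀ (by positivity)]
    rw [← mul_div_assoc, div_le_iff₀ (by positivity)] at hm
    linarith
  have hsq₁ : √(Λ / m₁) ≤ (1 - G.γ) / (32 * L) := by
    refine Real.sqrt_le_iff.2 ⟨by positivity, ?_⟩
    rw [div_le_iff₀ hm₁', div_pow, div_mul_eq_mul_div, le_div_iff₀ (by positivity)]
    rw [← mul_div_assoc, div_le_iff₀ (by positivity)] at hm₁
    linarith
  have hstep : ∀ i < R' + 1, G.γ ^ R * ((2 : ℝ)⁻¹ ^ i / (1 - G.γ)) + 2 * e i / (1 - G.γ) ≤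
      (2 : ℝ)⁻¹ ^ (i + 1) / (1 - G.γ) := by
    intro i hi
    have hy : ε * (1 - G.γ) / 2 ≤ (2 : ℝ)⁻¹ ^ i :=
      hpow'.trans (pow_le_pow_of_le_one (by norm_num) (by norm_num) (by omega))
    rw [hshift, ← mul_div_assoc, ← add_div, pow_succ]
    refine div_le_div_of_nonneg_right ?_ hγ.le
    have hy0 : 0 < (2 : ℝ)⁻¹ ^ i := by positivity
    set y := (2 : ℝ)⁻¹ ^ i
    have h1 : L / (1 - G.γ) * √(Λ / m) ≤ ε * (1 - G.γ) / 32 := by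
      calc L / (1 - G.γ) * √(Λ / m) ≤ L / (1 - G.γ) * (ε * (1 - G.γ) ^ 2 / (32 * L)) := by gcongr
        _ = _ := by field_simp
    have h2 : L * y / (1 - G.γ) * √(Λ / m₁) ≤ y / 32 := by
      calc L * y / (1 - G.γ) * √(Λ / m₁) ≤ L * y / (1 - G.γ) * ((1 - G.γ) / (32 * L)) := by gcongr
        _ = _ := by field_simp
    -- The three terms are at most `y / 8` (contraction), `ε * (1 - γ) / 8 ≤ y / 4` (reference
    -- error) and `y / 8` (inner error), together exactly `y / 2`.
    have h3 := mul_le_mul_of_nonneg_right hγR hy0.le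
    linarith
  have h := vrOuterLoop_spec (κ := 4 * Λ) (t₀ := 2 * (1 / (1 - G.γ)) * √(Λ / m))
    (t₁ := fun i => 2 * ((2 : ℝ)⁻¹ ^ i / (1 - G.γ)) * √(Λ / m₁)) (e := e) (n := R' + 1)
    (u := fun i => (2 : ℝ)⁻¹ ^ i / (1 - G.γ)) (R := R) hv hL.le (by positivity)
    (fun i => by positivity) hA hP hφ
    (fun i => le_of_eq (by rw [hshift]; ring)) hmpos hm₁pos (fun i => by positivity)
    (by
      rw [mul_pow, Real.sq_sqrt (by positivity)]
      have e1 : 2 * (m : ℝ) * ((2 * (1 / (1 - G.γ))) ^ 2 * (Λ / m)) =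
          2 * ((1 / (1 - G.γ)) ^ 2 * (4 * Λ)) := by field_simp; ring
      rw [e1]
      have : 0 ≤ (1 / (1 - G.γ)) ^ 2 * (4 * Λ) := by positivity
      linarith)
    (fun i => by
      rw [mul_pow, Real.sq_sqrt (by positivity)]
      have e1 : 2 * (m₁ : ℝ) * ((2 * ((2 : ℝ)⁻¹ ^ i / (1 - G.γ))) ^ 2 * (Λ / m₁)) =
          2 * (((2 : ℝ)⁻¹ ^ i / (1 - G.γ)) ^ 2 * (4 * Λ)) := by field_simp; ring
      rw [e1]
      have : 0 ≤ ((2 : ℝ)⁻¹ ^ i / (1 - G.γ)) ^ 2 * (4 * Λ) := by positivity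
      linarith)
    (by simp) hstep le_rfl
  refine (le_trans (measure_mono ?_) h).trans (ENNReal.ofReal_le_ofReal ?_)
  · refine Set.compl_subset_compl.2 fun θ hθ => ⟨hθ.1, fun s => (hθ.2 s).trans ?_⟩
    rw [div_le_iff₀ hγ, pow_succ]
    linarith
  · rw [hexp]
    set N : ℝ := (R' : ℝ) * R * K with hN
    have hN0 : 0 < N := by linarith
    -- The fourth power of `δ / N` leaves `(2 * δ) ^ 3 / N ^ 3` to absorb the numerical factor `8`;
    -- this uses `δ ≤ 1 / 2`.
    have h1 : ((R' + 1 : ℕ) : ℝ) * ((R + 1) * (K * (2 * (δ / N) ^ 4))) ≤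
        (2 * R') * (2 * R * (K * (2 * (δ / N) ^ 4))) := by
      push_cast
      gcongr <;> linarith
    refine h1.trans ?_
    have h2 : (2 * (R' : ℝ)) * (2 * R * (K * (2 * (δ / N) ^ 4))) = δ * ((2 * δ) ^ 3 / N ^ 3) := by
      calc _ = 8 * N * (δ / N) ^ 4 := by rw [hN]; ring
        _ = _ := by field_simp; ring
    rw [h2]
    refine mul_le_of_le_one_right hδ.le ((div_le_one (by positivity)).2 ?_)
    exact (pow_le_one₀ (by positivity) (by linarith)).trans (one_le_pow₀ hN1)

end OneSided

/-! ### The two-sided algorithm -/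

section TwoSided

variable [Fintype S] [MeasurableSpace S] [MeasurableSingletonClass S] {G : Game S A}
  {φ : S → A → Fin K → ℝ} {anchor : Fin K → S × A} {v : S → ℝ}

/-- The two runs bracket `v`: `Vmax G φ θ` bounds from below what player 1 secures, and the
reflection `1 / (1 - γ) - Vmax G.flip φ η` bounds from above what player 2 concedes. Each half of
the strategy is certified separately. -/
theorem IsTwoSidedStrategy.isOptimalUpTo {ε : ℝ} (hv : G.bellman v = v) {θ η : Params K}
    (hθ : IsLowerParams G φ θ) (hθε : ∀ s, v s - Vmax G φ θ s ≤ ε)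
    (hη : IsLowerParams G.flip φ η)
    (hηε : ∀ s, (1 / (1 - G.γ) - v s) - Vmax G.flip φ η s ≤ ε) {π : G.Strategy}
    (hπ : IsTwoSidedStrategy G φ (θ, η) π) : G.IsOptimalUpTo ε π := by
  refine ⟨v, Game.isEquilibriumValue_of_bellman_eq hv, fun s => ⟨fun π₁ => ?_, fun π₂ => ?_⟩⟩
  · have hq : ∀ s a, G.qval (fun t => 1 / (1 - G.γ) - Vmax G.flip φ η t) s a =
        1 / (1 - G.γ) - G.flip.qval (Vmax G.flip φ η) s a := fun s a => by
      have := G.flip_qval (fun t => 1 / (1 - G.γ) - Vmax G.flip φ η t) s a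
      simp only [sub_sub_cancel] at this
      linarith
    have h := Game.value_deviation_le (π := π)
      (u := fun t => 1 / (1 - G.γ) - Vmax G.flip φ η t) (e := 0)
      (fun t ht a ha => by
        have := hη.le_qval_of_notMem (s := t) (fun h => h ht) ha
        rw [hq]
        linarith)
      (fun t ht => by
        have := hη.le_qval_of_isMaxLinearAction (hπ.2 t ht)
        rw [hq]
        linarith) π₁ s
    rw [zero_div] at h
    linarith [hηε s]
  · have h := Game.le_value_deviation (π := π) (u := Vmax G φ θ) (e := 0)
      (fun t ht => by linarith [hθ.le_qval_of_isMaxLinearAction (hπ.1 t ht)])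
      (fun t ht a ha => by linarith [hθ.le_qval_of_notMem ht ha]) π₂ s
    rw [zero_div] at h
    linarith [hθε s]

theorem twoSidedAlgorithm_spec {L ε δ : ℝ} (hL : 0 < L) (hA : AnchorCondition G φ anchor L)
    (hP : Embeds G.P φ) (hφ : ∀ s a k, 0 ≤ φ s a k) (hK : 0 < K) (hε : 0 < ε) (hε1 : ε < 1)
    (hδ : 0 < δ) :
    ENNReal.ofReal (1 - 2 * δ) ≤ (twoSidedAlgorithm vrConst G φ anchor L ε δ).toOuterMeasure
      {θη | ∀ π : G.Strategy, IsTwoSidedStrategy G φ θη π → G.IsOptimalUpTo ε π} := by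
  -- For `δ > 1 / 2` the claimed probability is negative.
  rcases le_or_gt δ (1 / 2) with hδ1 | hδ1
  · obtain ⟨v, hv⟩ := G.exists_bellman_eq
    refine ofReal_one_sub_le_toOuterMeasure (by positivity) ?_
    rw [two_mul, ENNReal.ofReal_add hδ.le hδ.le, twoSidedAlgorithm]
    refine toOuterMeasure_bind_compl_le
      (oneSidedAlgorithm_spec hv hL hA hP hφ hK hε hε1 hδ hδ1) fun θ hθ => ?_
    refine toOuterMeasure_map_compl_le (oneSidedAlgorithm_spec (G := G.flip)
      (Game.flip_bellman_eq hv) hL hA hP hφ hK hε hε1 hδ hδ1) fun η hη π hπ => ?_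
    exact hπ.isOptimalUpTo hv hθ.1 hθ.2 hη.1 hη.2
  · rw [ENNReal.ofReal_of_nonpos (by linarith)]
    exact zero_le

theorem basicAlgorithm_spec {L ε δ : ℝ} (hL : 0 < L) (hA : AnchorCondition G φ anchor L)
    (hP : Embeds G.P φ) (hK : 0 < K) (hε : 0 < ε) (hε1 : ε < 1) (hδ : 0 < δ) (hδ1 : δ < 1) :
    ENNReal.ofReal (1 - δ) ≤ (basicAlgorithm 10 4 G φ anchor L ε δ).toOuterMeasure
      {w | ∀ π : G.Strategy, IsGreedy G φ w π → G.IsOptimalUpTo (2 * ε) π} := by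
  obtain ⟨v, hv⟩ := G.exists_bellman_eq
  refine ofReal_one_sub_le_toOuterMeasure hδ.le ?_
  refine le_trans (measure_mono ?_)
    (basicAlgorithm_nearOptimalQ hv hL hA hP hK hε hε1 hδ hδ1)
  refine Set.compl_subset_compl.2 fun w hw π hπ => ?_
  refine NearOptimalQ.isOptimalUpTo hv hw hπ (le_of_eq ?_)
  have := G.one_sub_γ_pos
  field_simp

theorem Game.IsOptimalUpTo.mono {ε ε' : ℝ} {π : G.Strategy} (h : G.IsOptimalUpTo ε π)
    (hε : ε ≤ ε') : G.IsOptimalUpTo ε' π := by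
  obtain ⟨v, hv, h⟩ := h
  exact ⟨v, hv, fun s => ⟨fun π₁ => ((h s).1 π₁).trans hε,
    fun π₂ => (neg_le_neg hε).trans ((h s).2 π₂)⟩⟩

theorem isOptimalUpTo_of_isEmpty [IsEmpty S] (ε : ℝ) (π : G.Strategy) : G.IsOptimalUpTo ε π := by
  obtain ⟨v, hv⟩ := G.exists_bellman_eq
  exact ⟨v, Game.isEquilibriumValue_of_bellman_eq hv, fun s => isEmptyElim s⟩

theorem toOuterMeasure_eq_one_of_forall {α : Type*} (p : PMF α) {s : Set α} (h : ∀ x, x ∈ s) :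
    p.toOuterMeasure s = 1 :=
  (p.toOuterMeasure_apply_eq_one_iff _).2 fun x _ => h x

end TwoSided

end TwoPlayerGame

end

open TwoPlayerGame in
theorem theorem3 :
    ∃ (cR cT : ℝ) (c : VRConst), 0 < cR ∧ 0 < cT ∧
      ∀ (S A : Type*) [Fintype S] [MeasurableSpace S] [MeasurableSingletonClass S]
        (K : ℕ) (G : Game S A) (φ : S → A → Fin K → ℝ) (anchor : Fin K → S × A)
        (P' : S → A → PMF S) (L ξ ε δ : ℝ),
        0 < L → AnchorCondition G φ anchor L →
        (∀ s a k, 0 ≤ φ s a k) →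
        Embeds P' φ →
        0 ≤ ξ → ξ ≤ 1 →
        (∀ s a, tvDist (G.P s a) (P' s a) ≤ ξ) →
        (∀ k, G.P (anchor k).1 (anchor k).2 = P' (anchor k).1 (anchor k).2) →
        0 < ε → ε < 1 → 0 < δ → δ < 1 →
        ENNReal.ofReal (1 - 2 * δ) ≤
            (twoSidedAlgorithm c G φ anchor L ε δ).toOuterMeasure
              {θη | ∀ π : G.Strategy, IsTwoSidedStrategy G φ θη π →
                G.IsOptimalUpTo (2 * ξ / (1 - G.γ) ^ 2 + 2 * ε) π} ∧
          ENNReal.ofReal (1 - δ) ≤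
            (basicAlgorithm cR cT G φ anchor L ε δ).toOuterMeasure
              {w | ∀ π : G.Strategy, IsGreedy G φ w π →
                G.IsOptimalUpTo (2 * ξ / (1 - G.γ) ^ 2 + 2 * ε) π} := by
  refine ⟨10, 4, vrConst, by norm_num, by norm_num, ?_⟩
  intro S A _ _ _ K G φ anchor P' L ξ ε δ hL hA hφ hP _ _ hξ hanchor hε hε1 hδ hδ1
  -- Without features an embedded model would have zero transition probabilities, so there are no
  -- states and optimality is vacuous.
  rcases K.eq_zero_or_pos with rfl | hK
  · have : IsEmpty S := ⟨fun s => isEmpty_of_embeds hP s (G.act_nonempty s).choose⟩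
    refine ⟨le_of_le_of_eq (ENNReal.ofReal_le_one.2 (by linarith))
      (toOuterMeasure_eq_one_of_forall _ fun _ π _ => ?_).symm,
      le_of_le_of_eq (ENNReal.ofReal_le_one.2 (by linarith))
      (toOuterMeasure_eq_one_of_forall _ fun _ π _ => ?_).symm⟩ <;>
    exact isOptimalUpTo_of_isEmpty _ π
  · rw [← twoSidedAlgorithm_withTransitions hanchor, ← basicAlgorithm_withTransitions hanchor]
    constructor
    · refine (twoSidedAlgorithm_spec (G := G.withTransitions P') hL hA hP hφ hK hε hε1 hδ).trans
        (measure_mono ?_)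
      intro θη h π hπ
      exact .of_withTransitions hξ (Game.IsOptimalUpTo.mono (h π hπ) (by linarith))
    · refine (basicAlgorithm_spec (G := G.withTransitions P') hL hA hP hK hε hε1 hδ hδ1).trans
        (measure_mono ?_)
      intro w h π hπ
      exact .of_withTransitions hξ (h π hπ)
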